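/- Let $(M,g)$ be a smooth Riemannian manifold and let $\nabla$ be a smooth metric connection on $M$ whose torsion $T(X,Y)=\nabla_XY-\nabla_YX-[X,Y]$ is totally skew-symmetric, i.e. $T(X,Y,Z)=g(T(X,Y),Z)$ is a $3$-form. Let $\nabla^g$ be the Levi-Civita connection, so $\nabla=\nabla^g+\frac12T$. Write $R(X,Y)Z=[\nabla_X,\nabla_Y]Z-\nabla_{[X,Y]}Z$, $R(X,Y,Z,V)=g(R(X,Y)Z,V)$, and, for an orthonormal basis $e_1,\dots,e_n$ of a tangent space, $$Ric(X,Y)=\sum_i R(e_i,X,Y,e_i),\qquad Scal=\sum_i Ric(e_i,e_i),\qquad \|T\|^2=\sum_{i,j,k}T(e_i,e_j,e_k)^2,$$ $$\sigma^T=\frac12\sum_j (e_j\lrcorner T)\wedge(e_j\lrcorner T),\qquad (e_j\lrcorner T)(X,Y)=T(e_j,X,Y).$$ (1) The curvature satisfies the Riemannian first Bianchi identity $$R(X,Y,Z,V)+R(Y,Z,X,V)+R(Z,X,Y,V)=0\quad\text{for all }X,Y,Z,V$$ if and only if $$dT=-2\nabla T=\tfrac23\sigma^T,$$ i.e. $dT(X,Y,Z,V)=-2(\nabla_XT)(Y,Z,V)=\frac23\sigma^T(X,Y,Z,V)$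 for all $X,Y,Z,V$. (2) Suppose these equivalent conditions hold. Let $\nabla^{1/3}=\nabla^g+\frac16T$, i.e. $\nabla^{1/3}=\nabla-\frac13T$, which is the metric connection with torsion $\frac13T$. Then $\nabla^{1/3}T=0$. In particular $\|T\|$ is constant on each connected component of $M$ (hence constant if $M$ is connected). Moreover the curvature of $\nabla$ satisfies the contracted Riemannian second Bianchi identity $$d(Scal)(X)-2\sum_i(\nabla_{e_i}Ric)(X,e_i)=0\quad\text{for all }X.$$ -/

import Mathlib

open Bundle
open scoped Manifold ContDiff

namespace SkewTorsion

noncomputable section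

section General

variable {E : Type*} [NormedAddCommGroup E] [NormedSpace ℝ E]
  {H : Type*} [TopologicalSpace H] {I : ModelWithCorners ℝ E H}
  {M : Type*} [TopologicalSpace M] [ChartedSpace H M] [IsManifold I 2 M]

variable (I) in
/-- The smooth local vector field through a tangent vector `v` at `x` used to evaluate tensors
at `x`: it is constant in the preferred trivialization of the tangent bundle at `x`, takes the
value `v` at `x`, and is smooth near `x`. All the operators below that are evaluated on such
fields are tensorial, so any other smooth field with value `v` at `x` gives the same result. -/
def ext {x : M} (v : TangentSpace I x) : Π y : M, TangentSpace I y :=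
  FiberBundle.extend E v

/-- A connection on (the tangent bundle of) `M`. -/
abbrev Connection (I : ModelWithCorners ℝ E H) (M : Type*) [TopologicalSpace M]
    [ChartedSpace H M] [IsManifold I 2 M] :=
  CovariantDerivative I E (TangentSpace I : M → Type _)

/-- A field of bilinear forms on the tangent spaces, with no linearity imposed. -/
abbrev Field2 (I : ModelWithCorners ℝ E H) (M : Type*) [TopologicalSpace M] [ChartedSpace H M] :=
  Π x : M, TangentSpace I x → TangentSpace I x → ℝ

/-- A field of trilinear forms on the tangent spaces, with no linearity imposed. -/
abbrev Field3 (I : ModelWithCorners ℝ E H) (M : Type*) [TopologicalSpace M] [ChartedSpace H M] :=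
  Π x : M, TangentSpace I x → TangentSpace I x → TangentSpace I x → ℝ

/-- The curvature operator on vector fields,
`R(X, Y) Z = ∇_X ∇_Y Z - ∇_Y ∇_X Z - ∇_{[X, Y]} Z`. -/
def curvatureOnFields (cov : Connection I M)
    (X Y Z : Π y : M, TangentSpace I y) (x : M) : TangentSpace I x :=
  cov (fun y ↦ cov Z y (Y y)) x (X x) - cov (fun y ↦ cov Z y (X y)) x (Y x)
    - cov Z x (VectorField.mlieBracket I X Y x)

/-- The curvature `R(X, Y) Z` of a connection on tangent vectors at a point. -/
def curvature (cov : Connection I M) (x : M)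
    (X Y Z : TangentSpace I x) : TangentSpace I x :=
  curvatureOnFields cov (ext I X) (ext I Y) (ext I Z) x

/-- `(∇_W α)(X, Y)` for a field `α` of bilinear forms. -/
def covDeriv2 (cov : Connection I M) (α : Field2 I M)
    (x : M) (W X Y : TangentSpace I x) : ℝ :=
  mvfderiv I (fun y ↦ α y (ext I X y) (ext I Y y)) x W
    - α x (cov (ext I X) x W) Y - α x X (cov (ext I Y) x W)

/-- `(∇_W α)(X, Y, Z)` for a field `α` of trilinear forms. -/
def covDeriv3 (cov : Connection I M) (α : Field3 I M)
    (x : M) (W X Y Z : TangentSpace I x) : ℝ :=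
  mvfderiv I (fun y ↦ α y (ext I X y) (ext I Y y) (ext I Z y)) x W
    - α x (cov (ext I X) x W) Y Z - α x X (cov (ext I Y) x W) Z - α x X Y (cov (ext I Z) x W)

/-- The exterior derivative of a `3`-form on vector fields, by the invariant formula
`dα(X₀, …, X₃) = ∑ (-1)^i X_i(α(…, X̂_i, …)) + ∑_{i < j} (-1)^(i + j) α([X_i, X_j], …)`. -/
def extDerivOnFields (α : Field3 I M) (X Y Z V : Π y : M, TangentSpace I y) (x : M) : ℝ :=
  mvfderiv I (fun y ↦ α y (Y y) (Z y) (V y)) x (X x)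
    - mvfderiv I (fun y ↦ α y (X y) (Z y) (V y)) x (Y x)
    + mvfderiv I (fun y ↦ α y (X y) (Y y) (V y)) x (Z x)
    - mvfderiv I (fun y ↦ α y (X y) (Y y) (Z y)) x (V x)
    - α x (VectorField.mlieBracket I X Y x) (Z x) (V x)
    + α x (VectorField.mlieBracket I X Z x) (Y x) (V x)
    - α x (VectorField.mlieBracket I X V x) (Y x) (Z x)
    - α x (VectorField.mlieBracket I Y Z x) (X x) (V x)
    + α x (VectorField.mlieBracket I Y V x) (X x) (Z x)
    - α x (VectorField.mlieBracket I Z V x) (X x) (Y x)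

/-- The exterior derivative of a `3`-form on tangent vectors at a point. -/
def extDeriv3 (α : Field3 I M) (x : M) (X Y Z V : TangentSpace I x) : ℝ :=
  extDerivOnFields α (ext I X) (ext I Y) (ext I Z) (ext I V) x

/-- The wedge product of two `2`-forms on a vector space, as a sum over the
`(2, 2)`-shuffles. -/
def wedge22 {W : Type*} (α β : W → W → ℝ) (X Y Z V : W) : ℝ :=
  α X Y * β Z V - α X Z * β Y V + α X V * β Y Z
    + α Y Z * β X V - α Y V * β X Z + α Z V * β X Y

/-- The connection `∇^t_X Y = ∇_X Y + ((t - 1) / 2) T(X, Y) = ∇_X Y + ((1 - t) / 2) T(Y, X)`,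
where `T` is the torsion of `∇`. When `∇` is
metric with skew-symmetric torsion `T`, the Levi-Civita connection is `∇^g = ∇ - T / 2`,
and `∇^t = ∇^g + (t / 2) T` is the metric connection with torsion `t T`. -/
def rescaledTorsion [FiniteDimensional ℝ E]
    (cov : Connection I M) (t : ℝ) :
    Connection I M :=
  cov.addOneForm (fun x ↦ ((1 - t) / 2) • cov.torsion x)

end General

section Riemannian

variable {E : Type*} [NormedAddCommGroup E] [NormedSpace ℝ E] [FiniteDimensional ℝ E]
  {H : Type*} [TopologicalSpace H] {I : ModelWithCorners ℝ E H}
  {M : Type*} [TopologicalSpace M] [ChartedSpace H M] [IsManifold I 2 M]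
  [RiemannianBundle (fun x : M ↦ TangentSpace I x)]

instance (x : M) : FiniteDimensional ℝ (TangentSpace I x) :=
  inferInstanceAs (FiniteDimensional ℝ E)

variable (I) in
/-- An orthonormal basis `e_1, …, e_n` of the tangent space at `x`. The sums over it below do not
depend on its choice. -/
def frame (x : M) : OrthonormalBasis (Fin (Module.finrank ℝ (TangentSpace I x))) ℝ
    (TangentSpace I x) :=
  stdOrthonormalBasis ℝ (TangentSpace I x)

/-- The connection is metric, `∇ g = 0`: for vector fields `X, Y, Z` with `Y, Z` differentiable
at `x`, one has `X g(Y, Z) = g(∇_X Y, Z) + g(Y, ∇_X Z)` at `x`. -/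
def IsMetric (cov : Connection I M) : Prop :=
  ∀ (x : M) (X : TangentSpace I x) (Y Z : Π y : M, TangentSpace I y),
    MDiffAt (T% Y) x → MDiffAt (T% Z) x →
      mvfderiv I (fun y ↦ inner ℝ (Y y) (Z y)) x X
        = inner ℝ (cov Y x X) (Z x) + inner ℝ (Y x) (cov Z x X)

/-- The torsion as a covariant `3`-tensor, `T(X, Y, Z) = g(T(X, Y), Z)`. -/
def torsion3 (cov : Connection I M) : Field3 I M :=
  fun x X Y Z ↦ inner ℝ (cov.torsion x X Y) Z

/-- The torsion is totally skew-symmetric: `T(X, Y, Z)`, which is always skew-symmetric in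
`X, Y`, is also skew-symmetric in `Y, Z`. -/
def HasSkewTorsion (cov : Connection I M) : Prop :=
  ∀ (x : M) (X Y Z : TangentSpace I x), torsion3 cov x X Y Z = - torsion3 cov x X Z Y

/-- The curvature as a covariant `4`-tensor, `R(X, Y, Z, V) = g(R(X, Y) Z, V)`. -/
def curvature4 (cov : Connection I M) (x : M)
    (X Y Z V : TangentSpace I x) : ℝ :=
  inner ℝ (curvature cov x X Y Z) V

/-- The Riemannian first Bianchi identity for the curvature of a connection. -/
def FirstBianchi (cov : Connection I M) : Prop :=
  ∀ (x : M) (X Y Z V : TangentSpace I x),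
    curvature4 cov x X Y Z V + curvature4 cov x Y Z X V + curvature4 cov x Z X Y V = 0

/-- The `4`-form `σ^T = (1 / 2) ∑_j (e_j ⌟ T) ∧ (e_j ⌟ T)`. -/
def sigma (cov : Connection I M) (x : M)
    (X Y Z V : TangentSpace I x) : ℝ :=
  (1 / 2) * ∑ j, wedge22 (torsion3 cov x (frame I x j)) (torsion3 cov x (frame I x j)) X Y Z V

/-- The squared norm `‖T‖² = ∑_{a, b, c} T(e_a, e_b, e_c)²`. -/
def torsionNormSq (cov : Connection I M) (x : M) : ℝ :=
  ∑ a, ∑ b, ∑ c, torsion3 cov x (frame I x a) (frame I x b) (frame I x c) ^ 2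

/-- The Ricci tensor `Ric(X, Y) = ∑_i R(e_i, X, Y, e_i)`. -/
def ricci (cov : Connection I M) : Field2 I M :=
  fun x X Y ↦ ∑ i, curvature4 cov x (frame I x i) X Y (frame I x i)

/-- The scalar curvature `Scal = ∑_i Ric(e_i, e_i)`. -/
def scal (cov : Connection I M) (x : M) : ℝ :=
  ∑ i, ricci cov x (frame I x i) (frame I x i)

/-- The contracted Riemannian second Bianchi identity
`d(Scal)(X) - 2 ∑_i (∇_{e_i} Ric)(X, e_i) = 0`. -/
def ContractedSecondBianchi (cov : Connection I M) :
    Prop :=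
  ∀ (x : M) (X : TangentSpace I x),
    mvfderiv I (scal cov) x X
      - 2 * ∑ i, covDeriv2 cov (ricci cov) x (frame I x i) X (frame I x i) = 0

end Riemannian

end

end SkewTorsion

/-! Everything follows from the two Bianchi identities of a connection with torsion. On smooth
vector fields they are formal consequences of additivity and the Jacobi identity (`curv_cyclic`,
`nabCurv_cyclic`); bump functions and tensoriality carry them to the pointwise tensors.

Total skewness gives T(T(a,b),c,d) = g(T(a,b),T(c,d)), so the quadratic torsion term in the first
identity is exactly σ. Hence the cyclic sum of R equals the cyclic sum of ∇T plus σ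
(`firstBianchi_sum`), while dT is the alternating sum of ∇T plus 2σ (`HasSkewTorsion.extDeriv3_eq`).
If R satisfies the Riemannian identity, the four cyclic shifts of the arguments give four linear
equations forcing ∇T = -σ/3 (`FirstBianchi.covDeriv3_eq`), and then dT = -4σ/3 + 2σ = 2σ/3.
Conversely ∇T = -σ/3 makes the cyclic sum of ∇T equal to -σ.

Passing from ∇ to ∇^t adds (1-t)/2 σ to ∇T, which cancels -σ/3 at t = 1/3. As ∇^{1/3} is metric, a
parallel T has constant norm: differentiating along a local orthonormal frame only rotates the frame
(`sum_bilin_skew`).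

For the last claim the second identity is contracted twice. The derivative terms give dScal and
twice the negative divergence of Ric. The torsion terms vanish: the first Bianchi identity yields
pair symmetry of R, so Ric is symmetric and its trace against the skew map T(X,·) is zero; the
remaining term pairs the 3-form T with a cyclic sum of R. -/

namespace SkewTorsion

noncomputable section

set_option linter.unusedSectionVars false

/-! ### Smooth vector fields, brackets and covariant derivatives. -/

section Fields

variable {E : Type*} [NormedAddCommGroup E] [NormedSpace ℝ E] [FiniteDimensional ℝ E]
  {H : Type*} [TopologicalSpace H] {I : ModelWithCorners ℝ E H}
  {M : Type*} [TopologicalSpace M] [ChartedSpace H M] [IsManifold I ∞ M]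

/-- Smooth vector fields on `M`. -/
abbrev VField (I : ModelWithCorners ℝ E H) (M : Type*) [TopologicalSpace M]
    [ChartedSpace H M] [IsManifold I ∞ M] :=
  ContMDiffSection I E ∞ (TangentSpace I : M → Type _)

/-- The product of a smooth function and a smooth vector field. -/
def fsmul (f : C^∞⟮I, M; 𝓘(ℝ, ℝ), ℝ⟯) (X : VField I M) : VField I M :=
  ⟨(f : M → ℝ) • (X : Π y : M, TangentSpace I y), f.contMDiff.smul_section X.contMDiff⟩

@[simp] lemma fsmul_apply (f : C^∞⟮I, M; 𝓘(ℝ, ℝ), ℝ⟯) (X : VField I M) (x : M) :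
    fsmul f X x = f x • X x := rfl

/-- The Lie bracket of smooth vector fields. -/
def br (X Y : VField I M) : VField I M :=
  ⟨VectorField.mlieBracket I X Y, fun x ↦
    have : IsManifold I (minSmoothness ℝ 2) M := by
      rw [minSmoothness_of_isRCLikeNormedField]; infer_instance
    have : IsManifold I (((⊤ : ℕ∞) : ℕ∞ω) + 1) M := ‹IsManifold I ∞ M›
    ContMDiffAt.mlieBracket_vectorField (m := ⊤) (n := ⊤) X.contMDiff.contMDiffAt
      Y.contMDiff.contMDiffAt (by simp)⟩

lemma br_add_left (X X' Y : VField I M) : br (X + X') Y = br X Y + br X' Y := by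
  ext x
  exact VectorField.mlieBracket_add_left X.mdifferentiableAt X'.mdifferentiableAt

lemma br_add_right (X Y Y' : VField I M) : br X (Y + Y') = br X Y + br X Y' := by
  ext x
  exact VectorField.mlieBracket_add_right Y.mdifferentiableAt Y'.mdifferentiableAt

lemma br_swap (X Y : VField I M) : br X Y = - br Y X := by
  ext x
  exact VectorField.mlieBracket_swap_apply

lemma br_jacobi (X Y Z : VField I M) : br X (br Y Z) = br (br X Y) Z + br Y (br X Z) := by
  ext x
  have h (W : VField I M) : CMDiffAt (minSmoothness ℝ 2) (T% fun y ↦ W y) x := by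
    simp only [minSmoothness_of_isRCLikeNormedField]
    exact (W.contMDiff.contMDiffAt).of_le (by norm_cast)
  have := IsManifold.of_le (I := I) (M := M) (m := minSmoothness ℝ 3) (n := ∞) (by
    simp only [minSmoothness_of_isRCLikeNormedField]; norm_cast)
  exact VectorField.leibniz_identity_mlieBracket_apply (h X) (h Y) (h Z)

lemma mdifferentiableAt_smooth (f : C^∞⟮I, M; 𝓘(ℝ, ℝ), ℝ⟯) (x : M) :
    MDifferentiableAt I 𝓘(ℝ, ℝ) f x :=
  f.contMDiff.mdifferentiableAt (by simp)

lemma br_fsmul_right (f : C^∞⟮I, M; 𝓘(ℝ, ℝ), ℝ⟯) (X Y : VField I M) (x : M) :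
    br X (fsmul f Y) x = mvfderiv I f x (X x) • Y x + f x • br X Y x :=
  VectorField.mlieBracket_smul_right (mdifferentiableAt_smooth f x) Y.mdifferentiableAt

lemma br_fsmul_left (f : C^∞⟮I, M; 𝓘(ℝ, ℝ), ℝ⟯) (X Y : VField I M) (x : M) :
    br (fsmul f X) Y x = -mvfderiv I f x (Y x) • X x + f x • br X Y x :=
  VectorField.mlieBracket_smul_left (mdifferentiableAt_smooth f x) X.mdifferentiableAt

section Connection

variable (cov : Connection I M)
  [hsmooth : CovariantDerivative.ContMDiffCovariantDerivative cov ∞]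

/-- The covariant derivative `∇_X Y` of smooth vector fields. -/
def nab (X Y : VField I M) : VField I M :=
  ⟨fun y ↦ cov Y y (X y), by
    have h := contMDiffOn_univ.1 (hsmooth.contMDiff.contMDiff
      (contMDiffOn_univ.2 (Y.contMDiff.of_le (by simp))))
    exact h.clm_bundle_apply X.contMDiff⟩

lemma nab_apply (X Y : VField I M) (x : M) : nab cov X Y x = cov Y x (X x) := rfl

lemma nab_add_left (X X' Y : VField I M) : nab cov (X + X') Y = nab cov X Y + nab cov X' Y := by
  ext x
  exact map_add (cov Y x) _ _

lemma nab_add_right (X Y Y' : VField I M) : nab cov X (Y + Y') = nab cov X Y + nab cov X Y' := by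
  ext x
  have := cov.isCovariantDerivativeOnUniv.add (Y.mdifferentiableAt (x := x))
    (Y'.mdifferentiableAt (x := x))
  exact congr($this (X x))

lemma nab_fsmul_left (f : C^∞⟮I, M; 𝓘(ℝ, ℝ), ℝ⟯) (X Y : VField I M) :
    nab cov (fsmul f X) Y = fsmul f (nab cov X Y) := by
  ext x
  exact map_smul (cov Y x) _ _

lemma nab_fsmul_right (f : C^∞⟮I, M; 𝓘(ℝ, ℝ), ℝ⟯) (X Y : VField I M) (x : M) :
    nab cov X (fsmul f Y) x = f x • nab cov X Y x + mvfderiv I f x (X x) • Y x := by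
  have := cov.isCovariantDerivativeOnUniv.leibniz (Y.mdifferentiableAt (x := x))
    (mdifferentiableAt_smooth f x)
  exact congr($this (X x))

end Connection

section Extension

variable [T2Space M]

/-- A vector field that is smooth near `x` agrees near `x` with a smooth vector field. -/
lemma exists_vfield_eventuallyEq {x : M} {s : Set M} (hs : s ∈ nhds x)
    {X : Π y : M, TangentSpace I y} (hX : CMDiff[s] ∞ (T% X)) :
    ∃ Y : VField I M, ∀ᶠ y in nhds x, Y y = X y := by
  obtain ⟨u, hus, hu, hxu⟩ := mem_nhds_iff.1 hs
  obtain ⟨ψ, -, hψ⟩ := (SmoothBumpFunction.nhds_basis_tsupport (I := I) x).mem_iff.1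
    (hu.mem_nhds hxu)
  refine ⟨⟨(ψ : M → ℝ) • X, ContMDiffOn.smul_section_of_tsupport ψ.contMDiff.contMDiffOn hu hψ
    (hX.mono hus)⟩, ?_⟩
  filter_upwards [ψ.eventuallyEq_one] with y hy
  change ψ y • X y = X y
  rw [hy]; simp

/-- A smooth vector field that agrees near `x` with `ext I v`. -/
lemma exists_vfield_ext {x : M} (v : TangentSpace I x) :
    ∃ Y : VField I M, ∀ᶠ y in nhds x, Y y = ext I v y := by
  obtain ⟨s, hs, h⟩ := FiberBundle.exists_contMDiffOn_extend (k := ∞) I E v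
  exact exists_vfield_eventuallyEq hs h

lemma ext_self {x : M} (v : TangentSpace I x) : ext I v x = v :=
  FiberBundle.extend_apply_self E v

lemma exists_vfield_apply {x : M} (v : TangentSpace I x) : ∃ Y : VField I M, Y x = v := by
  obtain ⟨Y, hY⟩ := exists_vfield_ext v
  exact ⟨Y, hY.self_of_nhds.trans (ext_self v)⟩

end Extension

end Fields

/-! ### Local orthonormal frames and tensoriality. -/

section Frames

variable {E : Type*} [NormedAddCommGroup E] [NormedSpace ℝ E] [FiniteDimensional ℝ E]
  {H : Type*} [TopologicalSpace H] {I : ModelWithCorners ℝ E H}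
  {M : Type*} [TopologicalSpace M] [ChartedSpace H M] [IsManifold I ∞ M]
  [RiemannianBundle (fun x : M ↦ TangentSpace I x)]
  [IsContMDiffRiemannianBundle I ∞ E (fun x : M ↦ TangentSpace I x)]

/-- The scalar product of two smooth vector fields. -/
def ip (X Y : VField I M) : C^∞⟮I, M; 𝓘(ℝ, ℝ), ℝ⟯ :=
  ⟨fun y ↦ inner ℝ (X y) (Y y), ContMDiff.inner_bundle X.contMDiff Y.contMDiff⟩

lemma ip_apply (X Y : VField I M) (x : M) : ip X Y x = inner ℝ (X x) (Y x) := rfl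

variable [T2Space M]

/-- The square root is smooth away from 0, so W/|W| is smooth near x; the bump-function extension
makes it global. -/
lemma exists_vfield_normalize (W : VField I M) {x : M} (hW : W x ≠ 0) :
    ∃ Y : VField I M, ∀ᶠ y in nhds x, W y ≠ 0 ∧ Y y = (√(inner ℝ (W y) (W y)))⁻¹ • W y := by
  have hc : ContinuousAt (ip W W) x := (ip W W).contMDiff.continuous.continuousAt
  have hs : {y | ip W W y ≠ 0} ∈ nhds x :=
    hc.eventually_ne (by simpa [ip_apply] using hW)
  have hsm : CMDiff[{y | ip W W y ≠ 0}] ∞ (fun y ↦ (√(ip W W y))⁻¹) := by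
    intro y hy
    have h1 : ContDiffAt ℝ ∞ (fun t : ℝ ↦ (√t)⁻¹) (ip W W y) :=
      (Real.contDiffAt_sqrt hy).inv (by
        rw [Real.sqrt_ne_zero (by rw [ip_apply]; exact real_inner_self_nonneg)]
        exact hy)
    exact (h1.contMDiffAt.comp y (ip W W).contMDiff.contMDiffAt).contMDiffWithinAt
  obtain ⟨Y, hY⟩ := exists_vfield_eventuallyEq hs
    (X := (fun y ↦ (√(ip W W y))⁻¹) • (W : Π y : M, TangentSpace I y))
    (hsm.smul_section W.contMDiff.contMDiffOn)
  refine ⟨Y, ?_⟩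
  filter_upwards [hY, hs] with y hy hy'
  refine ⟨fun h ↦ hy' (by simp [ip_apply, h]), hy⟩

/-- Gram–Schmidt, one index at a time. Since b is already orthonormal, neither the projection nor
the normalization alters the values at x, so the fields still extend b. -/
lemma exists_partial_frame {ι : Type*} [DecidableEq ι] {x : M}
    (b : ι → TangentSpace I x) (hb : Orthonormal ℝ b) (s : Finset ι) :
    ∃ e : ι → VField I M, (∀ i, e i x = b i) ∧
      ∀ᶠ y in nhds x, ∀ i ∈ s, ∀ j ∈ s, inner ℝ (e i y) (e j y) = if i = j then (1 : ℝ) else 0 := by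
  induction s using Finset.induction_on with
  | empty =>
    choose e he using fun i ↦ exists_vfield_apply (I := I) (b i)
    exact ⟨e, he, by simp⟩
  | insert a s ha ih =>
    obtain ⟨e, he, hs⟩ := ih
    let W : VField I M := e a - ∑ i ∈ s, fsmul (ip (e i) (e a)) (e i)
    have hWy (y : M) : W y = e a y - ∑ i ∈ s, inner ℝ (e i y) (e a y) • e i y := by
      have : (∑ i ∈ s, fsmul (ip (e i) (e a)) (e i)) y
          = ∑ i ∈ s, inner ℝ (e i y) (e a y) • e i y := by
        have := congr_fun (map_sum (ContMDiffSection.coeAddHom I E ∞ (TangentSpace I : M → Type _))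
          (fun i ↦ fsmul (ip (e i) (e a)) (e i)) s) y
        rw [Finset.sum_apply] at this
        exact this
      rw [← this]; rfl
    have hWx : W x = b a := by
      rw [hWy, Finset.sum_eq_zero, sub_zero, he]
      intro i hi
      rw [he, he, hb.2 (by rintro rfl; exact ha hi), zero_smul]
    obtain ⟨Y, hY⟩ := exists_vfield_normalize W (x := x) (by rw [hWx]; exact hb.ne_zero a)
    have hYx : Y x = b a := by
      rw [hY.self_of_nhds.2, hWx, real_inner_self_eq_norm_sq, hb.1]; simp
    refine ⟨Function.update e a Y, fun i ↦ ?_, ?_⟩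
    · by_cases h : i = a
      · subst h; simpa using hYx
      · simpa [h] using he i
    · filter_upwards [hs, hY] with y hy ⟨hW0, hYy⟩
      have horth : ∀ i ∈ s, inner ℝ (e i y) (Y y) = (0 : ℝ) := by
        intro i hi
        rw [hYy, inner_smul_right]
        refine mul_eq_zero_of_right _ ?_
        rw [hWy, inner_sub_right, inner_sum, Finset.sum_eq_single i]
        · rw [inner_smul_right, hy i hi i hi]; simp
        · intro j hj hji
          rw [inner_smul_right, hy i hi j hj, if_neg hji.symm, mul_zero]
        · exact fun h ↦ absurd hi h
      have hne : ∀ i ∈ s, i ≠ a := fun i hi h ↦ ha (h ▸ hi)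
      intro i hi j hj
      rw [Finset.mem_insert] at hi hj
      rcases hi with rfl | hi <;> rcases hj with rfl | hj
      · simp only [Function.update_self, if_true]
        have h0 : (0 : ℝ) < inner ℝ (W y) (W y) := real_inner_self_pos.2 hW0
        rw [hYy, inner_smul_left, inner_smul_right]
        have := Real.mul_self_sqrt h0.le
        have h1 : √(inner ℝ (W y) (W y)) ≠ 0 := (Real.sqrt_pos.2 h0).ne'
        simp only [conj_trivial]
        field_simp
        rw [sq, this]
      · rw [Function.update_self, Function.update_of_ne (hne j hj), real_inner_comm, horth j hj,
          if_neg (hne j hj).symm]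
      · rw [Function.update_self, Function.update_of_ne (hne i hi), horth i hi, if_neg (hne i hi)]
      · rw [Function.update_of_ne (hne i hi), Function.update_of_ne (hne j hj), hy i hi j hj]

/-- A family of smooth vector fields, orthonormal near `x`, that extends the frame at `x`. -/
lemma exists_frame (x : M) :
    ∃ e : Fin (Module.finrank ℝ (TangentSpace I x)) → VField I M, (∀ i, e i x = frame I x i) ∧
      ∀ᶠ y in nhds x, Orthonormal ℝ fun i ↦ e i y := by
  obtain ⟨e, he, h⟩ := exists_partial_frame (frame I x) (frame I x).orthonormal Finset.univ
  refine ⟨e, he, ?_⟩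
  filter_upwards [h] with y hy
  rw [orthonormal_iff_ite]
  exact fun i j ↦ hy i (Finset.mem_univ _) j (Finset.mem_univ _)

/-- The orthonormal basis given by an orthonormal family of vector fields of the right length. -/
def frameBasis {x y : M} (e : Fin (Module.finrank ℝ (TangentSpace I x)) → VField I M)
    (h : Orthonormal ℝ fun i ↦ e i y) :
    OrthonormalBasis (Fin (Module.finrank ℝ (TangentSpace I x))) ℝ (TangentSpace I y) :=
  OrthonormalBasis.mk h (by
    have := h.linearIndependent.span_eq_top_of_card_eq_finrank' (by rw [Fintype.card_fin]; rfl)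
    rw [this])

@[simp] lemma frameBasis_apply {x y : M}
    (e : Fin (Module.finrank ℝ (TangentSpace I x)) → VField I M)
    (h : Orthonormal ℝ fun i ↦ e i y) (i) : frameBasis e h i = e i y := by
  simp [frameBasis]

/-- A smooth vector field vanishing at `x` is a combination of smooth vector fields with
coefficients vanishing at `x`. -/
lemma exists_sum_fsmul_of_apply_eq_zero {X : VField I M} {x : M} (hX : X x = 0) :
    ∃ (n : ℕ) (f : Fin n → C^∞⟮I, M; 𝓘(ℝ, ℝ), ℝ⟯) (Y : Fin n → VField I M),
      (∀ i, f i x = 0) ∧ X = ∑ i, fsmul (f i) (Y i) := by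
  obtain ⟨e, -, he⟩ := exists_frame (I := I) x
  obtain ⟨u, hu, ho, hx⟩ := eventually_nhds_iff.1 he
  obtain ⟨ψ, -, hψ⟩ := (SmoothBumpFunction.nhds_basis_tsupport (I := I) x).mem_iff.1
    (ho.mem_nhds hx)
  let Ψ : C^∞⟮I, M; 𝓘(ℝ, ℝ), ℝ⟯ := ⟨ψ, ψ.contMDiff⟩
  -- With ψ = 1 near x and supported where e is orthonormal, X = (1 - ψ) X + ∑ ψ g(e_i, X) e_i; all
  -- the coefficients vanish at x.
  refine ⟨_, Fin.cons (1 - Ψ) fun i ↦ Ψ * ip (e i) X, Fin.cons X e, ?_, ?_⟩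
  · refine Fin.cases ?_ fun i ↦ ?_
    · change 1 - ψ x = 0
      simp
    · change ψ x * inner ℝ (e i x) (X x) = 0
      rw [hX, inner_zero_right, mul_zero]
  · rw [Fin.sum_univ_succ]
    simp only [Fin.cons_zero, Fin.cons_succ]
    ext y
    have hsum : (∑ i, fsmul (Ψ * ip (e i) X) (e i)) y
        = ψ y • ∑ i, inner ℝ (e i y) (X y) • e i y := by
      have := congr_fun (map_sum (ContMDiffSection.coeAddHom I E ∞ (TangentSpace I : M → Type _))
        (fun i ↦ fsmul (Ψ * ip (e i) X) (e i)) Finset.univ) y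
      rw [Finset.sum_apply] at this
      refine this.trans ?_
      rw [Finset.smul_sum]
      refine Finset.sum_congr rfl fun i _ ↦ ?_
      rw [smul_smul]; rfl
    change X y = (1 - ψ y) • X y + (∑ i, fsmul (Ψ * ip (e i) X) (e i)) y
    rw [hsum]
    by_cases hy : y ∈ tsupport ψ
    · have := (frameBasis e (hu y (hψ hy))).sum_repr' (X y)
      simp only [frameBasis_apply] at this
      rw [this]
      module
    · rw [image_eq_zero_of_notMem_tsupport hy]
      module

/-- A `C^∞`-linear operation on vector fields only depends on pointwise values. -/
lemma apply_eq_of_tensorial {A : Type*} [AddCommGroup A] [Module ℝ A] (F : VField I M → A)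
    {x : M} (hadd : ∀ X Y, F (X + Y) = F X + F Y)
    (hsmul : ∀ (f : C^∞⟮I, M; 𝓘(ℝ, ℝ), ℝ⟯) X, F (fsmul f X) = f x • F X)
    {X Y : VField I M} (h : X x = Y x) : F X = F Y := by
  let G : VField I M →+ A := AddMonoidHom.mk' F hadd
  have hG : G (X - Y) = 0 := by
    obtain ⟨n, f, Z, hf, hZ⟩ := exists_sum_fsmul_of_apply_eq_zero (X := X - Y) (x := x)
      (by change X x - Y x = 0; rw [h, sub_self])
    rw [hZ, map_sum]
    refine Finset.sum_eq_zero fun i _ ↦ ?_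
    change F _ = 0
    rw [hsmul, hf, zero_smul]
  rw [map_sub] at hG
  exact sub_eq_zero.1 hG

end Frames

/-! ### Bianchi identities with torsion, and locality of the curvature. -/

section Bianchi

variable {E : Type*} [NormedAddCommGroup E] [NormedSpace ℝ E] [FiniteDimensional ℝ E]
  {H : Type*} [TopologicalSpace H] {I : ModelWithCorners ℝ E H}
  {M : Type*} [TopologicalSpace M] [ChartedSpace H M] [IsManifold I ∞ M]

lemma br_neg_right (X Y : VField I M) : br X (-Y) = -br X Y :=
  map_neg (AddMonoidHom.mk' (br X) (br_add_right X)) Y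

lemma br_neg_left (X Y : VField I M) : br (-X) Y = -br X Y := by
  rw [br_swap, br_neg_right, br_swap Y X, neg_neg]

lemma br_sub_left (X Y Z : VField I M) : br (X - Y) Z = br X Z - br Y Z :=
  map_sub (AddMonoidHom.mk' (br · Z) (br_add_left · · Z)) X Y

variable (cov : Connection I M)
  [hsmooth : CovariantDerivative.ContMDiffCovariantDerivative cov ∞]

lemma nab_sub_right (X Y Z : VField I M) : nab cov X (Y - Z) = nab cov X Y - nab cov X Z :=
  map_sub (AddMonoidHom.mk' (nab cov X) (nab_add_right cov X)) Y Z

lemma nab_sub_left (X Y Z : VField I M) : nab cov (X - Y) Z = nab cov X Z - nab cov Y Z :=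
  map_sub (AddMonoidHom.mk' (nab cov · Z) (nab_add_left cov · · Z)) X Y

lemma nab_neg_left (X Z : VField I M) : nab cov (-X) Z = -nab cov X Z :=
  map_neg (AddMonoidHom.mk' (nab cov · Z) (nab_add_left cov · · Z)) X

/-- The torsion on smooth vector fields. -/
def tor (X Y : VField I M) : VField I M := nab cov X Y - nab cov Y X - br X Y

lemma tor_apply (X Y : VField I M) (x : M) : tor cov X Y x = cov.torsion x (X x) (Y x) :=
  (cov.torsion_apply X.mdifferentiableAt Y.mdifferentiableAt).symm

/-- The curvature on smooth vector fields. -/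
def curv (X Y Z : VField I M) : VField I M :=
  nab cov X (nab cov Y Z) - nab cov Y (nab cov X Z) - nab cov (br X Y) Z

/-- The covariant derivative `(∇_W T)(X, Y)` of the torsion. -/
def nabTor (W X Y : VField I M) : VField I M :=
  nab cov W (tor cov X Y) - tor cov (nab cov W X) Y - tor cov X (nab cov W Y)

/-- The covariant derivative `(∇_W R)(X, Y) Z` of the curvature. -/
def nabCurv (W X Y Z : VField I M) : VField I M :=
  nab cov W (curv cov X Y Z) - curv cov (nab cov W X) Y Z - curv cov X (nab cov W Y) Z
    - curv cov X Y (nab cov W Z)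

lemma br_jacobi_cyclic (X Y Z : VField I M) :
    br (br X Y) Z + br (br Y Z) X + br (br Z X) Y = 0 := by
  have h := br_jacobi X Y Z
  rw [br_swap X (br Y Z), br_swap Y (br X Z), br_swap X Z, br_neg_left] at h
  rw [neg_eq_iff_add_eq_zero] at h
  rw [← h]; abel

/-- First Bianchi identity with torsion. After expansion into ∇ and brackets, all terms cancel
except the Jacobi sum. -/
lemma curv_cyclic (X Y Z : VField I M) :
    curv cov X Y Z + curv cov Y Z X + curv cov Z X Y
      = nabTor cov X Y Z + nabTor cov Y Z X + nabTor cov Z X Y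
        + (tor cov (tor cov X Y) Z + tor cov (tor cov Y Z) X + tor cov (tor cov Z X) Y) := by
  have h := neg_eq_zero.2 (br_jacobi_cyclic X Y Z)
  simp only [curv, nabTor, tor, nab_sub_left, nab_sub_right, br_sub_left]
  rw [br_swap Y (nab cov X Z), br_swap Z (nab cov Y X), br_swap X (nab cov Z Y), ← sub_eq_zero,
    ← h]
  abel

/-- Second Bianchi identity with torsion. The only surviving terms are ∇ along the cyclic sum of
double brackets, zero by Jacobi. -/
lemma nabCurv_cyclic (X Y Z V : VField I M) :
    nabCurv cov X Y Z V + nabCurv cov Y Z X V + nabCurv cov Z X Y V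
      + (curv cov (tor cov X Y) Z V + curv cov (tor cov Y Z) X V + curv cov (tor cov Z X) Y V)
      = 0 := by
  have h : nab cov (br (br X Y) Z) V + nab cov (br (br Y Z) X) V + nab cov (br (br Z X) Y) V
      = 0 := by
    rw [← nab_add_left, ← nab_add_left, br_jacobi_cyclic]
    exact map_zero (AddMonoidHom.mk' (nab cov · V) (nab_add_left cov · · V))
  simp only [curv, nabCurv, tor, nab_sub_left, nab_sub_right, br_sub_left]
  rw [br_swap Y (nab cov X Z), br_swap Z (nab cov Y X), br_swap X (nab cov Z Y)]
  simp only [nab_neg_left]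
  rw [← h]
  abel

/-- The functions `gX`, `gY` stand for X f and Y f. Comparing the Jacobi identity for X, Y, f Z with
f times the one for X, Y, Z leaves a multiple of Z, whose coefficient is the claim wherever Z is
nonzero. If the tangent space is trivial, both sides are 0. -/
lemma mvfderiv_br {f gX gY : C^∞⟮I, M; 𝓘(ℝ, ℝ), ℝ⟯} {X Y : VField I M} [T2Space M]
    (hX : ∀ y, gX y = mvfderiv I f y (X y)) (hY : ∀ y, gY y = mvfderiv I f y (Y y)) (x : M) :
    mvfderiv I gY x (X x) - mvfderiv I gX x (Y x) = mvfderiv I f x (br X Y x) := by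
  by_cases hv : ∃ v : TangentSpace I x, v ≠ 0
  · obtain ⟨v, hv⟩ := hv
    obtain ⟨Z, rfl⟩ := exists_vfield_apply v
    have key (W : VField I M) (g : C^∞⟮I, M; 𝓘(ℝ, ℝ), ℝ⟯)
        (hg : ∀ y, g y = mvfderiv I f y (W y)) : br W (fsmul f Z) = fsmul g Z + fsmul f (br W Z) := by
      ext y
      rw [br_fsmul_right, ← hg]; rfl
    have h := congr($(br_jacobi X Y (fsmul f Z)) x)
    rw [key X gX hX, key Y gY hY, br_add_right, br_add_right] at h
    have h' := congr($(br_jacobi X Y Z) x)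
    simp only [ContMDiffSection.coe_add, Pi.add_apply, br_fsmul_right] at h h'
    rw [← hX, ← hY] at h
    rw [h'] at h
    have : (mvfderiv I gY x (X x) - mvfderiv I gX x (Y x) - mvfderiv I f x (br X Y x)) • Z x
        = 0 := by
      rw [← sub_eq_zero] at h
      rw [← h]
      module
    exact sub_eq_zero.1 ((smul_eq_zero.1 this).resolve_right hv)
  · push Not at hv
    rw [hv (X x), hv (Y x), hv (br X Y x)]; simp

section Curvature

variable [T2Space M]

lemma cov_congr {x : M} {X : Π y : M, TangentSpace I y} {Y : VField I M}
    (h : ∀ᶠ y in nhds x, Y y = X y) : cov X x = cov Y x := by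
  have hY : MDiffAt (T% fun y ↦ Y y) x := Y.mdifferentiableAt
  have hX : MDiffAt (T% X) x := hY.congr_of_eventuallyEq (by
    filter_upwards [h] with y hy
    rw [hy])
  exact cov.isCovariantDerivativeOnUniv.congr_of_eventuallyEq hX hY Filter.univ_mem
    (h.mono fun _ h ↦ h.symm)

lemma curvatureOnFields_congr {x : M} {X Y Z : Π y : M, TangentSpace I y} {X' Y' Z' : VField I M}
    (hX : ∀ᶠ y in nhds x, X' y = X y) (hY : ∀ᶠ y in nhds x, Y' y = Y y)
    (hZ : ∀ᶠ y in nhds x, Z' y = Z y) :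
    curvatureOnFields cov X Y Z x = curv cov X' Y' Z' x := by
  have h1 (W : Π y : M, TangentSpace I y) (W' : VField I M) (hW : ∀ᶠ y in nhds x, W' y = W y) :
      ∀ᶠ y in nhds x, nab cov W' Z' y = cov Z y (W y) := by
    -- The curvature differentiates twice, so ∇Z must agree on a neighbourhood of x and not only at
    -- x.
    filter_upwards [hW, hZ.eventually_nhds] with y hy hy'
    rw [nab_apply, cov_congr cov hy', hy]
  unfold curvatureOnFields
  rw [cov_congr cov (h1 X X' hX), cov_congr cov (h1 Y Y' hY), cov_congr cov hZ,
    ← hX.self_of_nhds, ← hY.self_of_nhds,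
    Filter.EventuallyEq.mlieBracket_vectorField_eq (V₁ := X) (V := X') (W₁ := Y) (W := Y')
      (hX.mono fun _ h ↦ h.symm) (hY.mono fun _ h ↦ h.symm)]
  rfl

lemma tor_add_left (X X' Y : VField I M) : tor cov (X + X') Y = tor cov X Y + tor cov X' Y := by
  simp only [tor, nab_add_left, nab_add_right, br_add_left]; abel

lemma curv_add_left (X X' Y Z : VField I M) :
    curv cov (X + X') Y Z = curv cov X Y Z + curv cov X' Y Z := by
  simp only [curv, nab_add_left, nab_add_right, br_add_left]; abel

lemma curv_swap (X Y Z : VField I M) : curv cov X Y Z = -curv cov Y X Z := by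
  simp only [curv]
  rw [br_swap X Y, nab_neg_left]; abel

lemma curv_add_mid (X Y Y' Z : VField I M) :
    curv cov X (Y + Y') Z = curv cov X Y Z + curv cov X Y' Z := by
  rw [curv_swap, curv_add_left, curv_swap cov X Y, curv_swap cov X Y']; abel

lemma curv_fsmul_left (f : C^∞⟮I, M; 𝓘(ℝ, ℝ), ℝ⟯) (X Y Z : VField I M) (x : M) :
    curv cov (fsmul f X) Y Z x = f x • curv cov X Y Z x := by
  simp only [curv, ContMDiffSection.coe_sub, Pi.sub_apply]
  rw [nab_fsmul_left, nab_fsmul_left, nab_fsmul_right, nab_apply cov (br (fsmul f X) Y),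
    br_fsmul_left, map_add, map_smul, map_smul, nab_apply cov (br X Y), nab_apply cov X Z,
    fsmul_apply]
  module

lemma curv_fsmul_mid (f : C^∞⟮I, M; 𝓘(ℝ, ℝ), ℝ⟯) (X Y Z : VField I M) (x : M) :
    curv cov X (fsmul f Y) Z x = f x • curv cov X Y Z x := by
  rw [curv_swap, curv_swap cov X Y]
  change -(curv cov (fsmul f Y) X Z x) = f x • -(curv cov Y X Z x)
  rw [curv_fsmul_left, smul_neg]

end Curvature

end Bianchi

/-! ### Curvature of a metric connection as a tensor. -/

section Metric

variable {E : Type*} [NormedAddCommGroup E] [NormedSpace ℝ E] [FiniteDimensional ℝ E]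
  {H : Type*} [TopologicalSpace H] {I : ModelWithCorners ℝ E H}
  {M : Type*} [TopologicalSpace M] [ChartedSpace H M] [IsManifold I ∞ M] [T2Space M]
  [RiemannianBundle (fun x : M ↦ TangentSpace I x)]
  [IsContMDiffRiemannianBundle I ∞ E (fun x : M ↦ TangentSpace I x)]
  (cov : Connection I M)
  [hsmooth : CovariantDerivative.ContMDiffCovariantDerivative cov ∞]

variable {cov} in
lemma IsMetric.mvfderiv_ip (hm : IsMetric cov) (X Y Z : VField I M) (x : M) :
    mvfderiv I (ip Y Z) x (X x) = ip (nab cov X Y) Z x + ip Y (nab cov X Z) x :=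
  hm x (X x) Y Z Y.mdifferentiableAt Z.mdifferentiableAt

lemma ip_sub_left (X Y Z : VField I M) (x : M) : ip (X - Y) Z x = ip X Z x - ip Y Z x :=
  inner_sub_left (X x) (Y x) (Z x)

lemma ip_add_left (X Y Z : VField I M) (x : M) : ip (X + Y) Z x = ip X Z x + ip Y Z x :=
  inner_add_left (X x) (Y x) (Z x)

lemma ip_comm (X Y : VField I M) : ip X Y = ip Y X := by
  ext x
  exact real_inner_comm (Y x) (X x)

/-- The operator XY - YX - [X,Y] kills the function g(Z,V). Expanding by metricity, the mixed terms
cancel and the two curvature terms remain. -/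
lemma ip_curv_skew (hm : IsMetric cov) (X Y Z V : VField I M) (x : M) :
    ip (curv cov X Y Z) V x = -ip (curv cov X Y V) Z x := by
  let g (W : VField I M) : C^∞⟮I, M; 𝓘(ℝ, ℝ), ℝ⟯ := ip (nab cov W Z) V + ip Z (nab cov W V)
  have hg (W : VField I M) (y : M) : g W y = mvfderiv I (ip Z V) y (W y) :=
    (hm.mvfderiv_ip W Z V y).symm
  have h := mvfderiv_br (hg X) (hg Y) x
  have hd (W W' : VField I M) : mvfderiv I (g W) x (W' x)
      = mvfderiv I (ip (nab cov W Z) V) x (W' x) + mvfderiv I (ip Z (nab cov W V)) x (W' x) := by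
    have := mvfderiv_add (mdifferentiableAt_smooth (ip (nab cov W Z) V) x)
      (mdifferentiableAt_smooth (ip Z (nab cov W V)) x)
    exact congr($this (W' x))
  rw [hd, hd] at h
  simp only [hm.mvfderiv_ip] at h
  simp only [curv, ip_sub_left]
  rw [ip_comm (nab cov X (nab cov Y V)), ip_comm (nab cov Y (nab cov X V)),
    ip_comm (nab cov (br X Y) V)]
  linarith

lemma ext_of_ip {X Y : VField I M} {x : M} (h : ∀ V, ip X V x = ip Y V x) : X x = Y x := by
  refine ext_inner_right ℝ fun v ↦ ?_
  obtain ⟨V, rfl⟩ := exists_vfield_apply v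
  exact h V

/-- The first two slots are tensorial by direct computation. For the third, skewness moves Z into
the scalar product, where only its value at x matters. -/
lemma curv_apply_congr (hm : IsMetric cov) {X Y Z X' Y' Z' : VField I M} {x : M}
    (hX : X x = X' x) (hY : Y x = Y' x) (hZ : Z x = Z' x) :
    curv cov X Y Z x = curv cov X' Y' Z' x := by
  have h1 : curv cov X Y Z x = curv cov X' Y Z x :=
    apply_eq_of_tensorial (fun X ↦ curv cov X Y Z x)
      (fun X X' ↦ congr($(curv_add_left cov X X' Y Z) x))
      (fun f X ↦ curv_fsmul_left cov f X Y Z x) hX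
  have h2 : curv cov X' Y Z x = curv cov X' Y' Z x :=
    apply_eq_of_tensorial (fun Y ↦ curv cov X' Y Z x)
      (fun Y Y' ↦ congr($(curv_add_mid cov X' Y Y' Z) x))
      (fun f Y ↦ curv_fsmul_mid cov f X' Y Z x) hY
  rw [h1, h2]
  refine ext_of_ip fun V ↦ ?_
  rw [ip_curv_skew cov hm, ip_curv_skew cov hm X' Y' Z', ip_apply, hZ, ← ip_apply]

lemma curvature_apply (hm : IsMetric cov) (X Y Z : VField I M) (x : M) :
    curvature cov x (X x) (Y x) (Z x) = curv cov X Y Z x := by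
  obtain ⟨X', hX⟩ := exists_vfield_ext (X x)
  obtain ⟨Y', hY⟩ := exists_vfield_ext (Y x)
  obtain ⟨Z', hZ⟩ := exists_vfield_ext (Z x)
  rw [curvature, curvatureOnFields_congr cov hX hY hZ]
  exact curv_apply_congr cov hm (hX.self_of_nhds.trans (ext_self _))
    (hY.self_of_nhds.trans (ext_self _)) (hZ.self_of_nhds.trans (ext_self _))

lemma curvature4_apply (hm : IsMetric cov) (X Y Z V : VField I M) (x : M) :
    curvature4 cov x (X x) (Y x) (Z x) (V x) = ip (curv cov X Y Z) V x := by
  rw [curvature4, curvature_apply cov hm, ip_apply]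

lemma torsion3_apply (X Y Z : VField I M) (x : M) :
    torsion3 cov x (X x) (Y x) (Z x) = ip (tor cov X Y) Z x := by
  rw [torsion3, ip_apply, tor_apply]

end Metric

/-! ### Algebra of the torsion 3-form, its covariant and exterior derivatives. -/

section Torsion

variable {E : Type*} [NormedAddCommGroup E] [NormedSpace ℝ E] [FiniteDimensional ℝ E]
  {H : Type*} [TopologicalSpace H] {I : ModelWithCorners ℝ E H}
  {M : Type*} [TopologicalSpace M] [ChartedSpace H M] [IsManifold I ∞ M] [T2Space M]
  [RiemannianBundle (fun x : M ↦ TangentSpace I x)]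
  [IsContMDiffRiemannianBundle I ∞ E (fun x : M ↦ TangentSpace I x)]
  {cov : Connection I M}

lemma torsion3_add (x : M) (a a' b c : TangentSpace I x) :
    torsion3 cov x (a + a') b c = torsion3 cov x a b c + torsion3 cov x a' b c := by
  simp only [torsion3, map_add, add_apply]
  exact inner_add_left (cov.torsion x a b) (cov.torsion x a' b) c

lemma torsion3_smul (x : M) (r : ℝ) (a b c : TangentSpace I x) :
    torsion3 cov x (r • a) b c = r * torsion3 cov x a b c := by
  simp only [torsion3, map_smul, smul_apply]
  exact real_inner_smul_left (cov.torsion x a b) c r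

lemma torsion3_sub (x : M) (a a' b c : TangentSpace I x) :
    torsion3 cov x (a - a') b c = torsion3 cov x a b c - torsion3 cov x a' b c := by
  rw [sub_eq_add_neg, torsion3_add, ← neg_one_smul ℝ a', torsion3_smul]; ring

lemma torsion3_swap_left (x : M) (a b c : TangentSpace I x) :
    torsion3 cov x a b c = -torsion3 cov x b a c := by
  rw [torsion3, cov.torsion_antisymm]
  exact inner_neg_left (cov.torsion x b a) c

lemma HasSkewTorsion.swap_mid (hs : HasSkewTorsion cov) (x : M) (a b c : TangentSpace I x) :
    torsion3 cov x a b c = torsion3 cov x c a b := by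
  rw [hs, torsion3_swap_left, neg_neg]

/-- The scalar product `g(T(a, b), T(c, d))`. -/
def torsionPair (cov : Connection I M) (x : M) (a b c d : TangentSpace I x) : ℝ :=
  inner ℝ (cov.torsion x a b) (cov.torsion x c d)

lemma torsionPair_swap_left (x : M) (a b c d : TangentSpace I x) :
    torsionPair cov x a b c d = -torsionPair cov x b a c d := by
  rw [torsionPair, cov.torsion_antisymm]
  exact inner_neg_left (cov.torsion x b a) (cov.torsion x c d)

lemma torsionPair_comm (x : M) (a b c d : TangentSpace I x) :
    torsionPair cov x a b c d = torsionPair cov x c d a b :=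
  real_inner_comm (cov.torsion x c d) (cov.torsion x a b)

lemma torsionPair_swap_right (x : M) (a b c d : TangentSpace I x) :
    torsionPair cov x a b c d = -torsionPair cov x a b d c := by
  rw [torsionPair_comm, torsionPair_swap_left, torsionPair_comm x a b]

/-- Cyclic invariance of the 3-form moves T(a,b) into the last slot. -/
lemma HasSkewTorsion.torsion3_torsion (hs : HasSkewTorsion cov) (x : M)
    (a b c d : TangentSpace I x) :
    torsion3 cov x (cov.torsion x a b) c d = torsionPair cov x a b c d := by
  rw [← hs.swap_mid]
  exact real_inner_comm (cov.torsion x a b) (cov.torsion x c d)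

/-- Parseval in the frame turns each sum over j into a `torsionPair`. The six shuffles coincide in
pairs, which absorbs the factor 1/2. -/
lemma HasSkewTorsion.sigma_eq (hs : HasSkewTorsion cov) (x : M) (a b c d : TangentSpace I x) :
    sigma cov x a b c d = torsionPair cov x a b c d - torsionPair cov x a c b d
      + torsionPair cov x a d b c := by
  have key (a b c d : TangentSpace I x) :
      ∑ j, torsion3 cov x (frame I x j) a b * torsion3 cov x (frame I x j) c d
        = torsionPair cov x a b c d := by
    rw [torsionPair, ← (frame I x).sum_inner_mul_inner]
    refine Finset.sum_congr rfl fun j _ ↦ ?_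
    rw [← hs.swap_mid x a b, ← hs.swap_mid x c d, torsion3, torsion3, real_inner_comm (cov.torsion x c d)]
  simp only [sigma, wedge22, Finset.sum_add_distrib, Finset.sum_sub_distrib, key]
  rw [torsionPair_comm x b c, torsionPair_comm x b d, torsionPair_comm x c d]
  ring

lemma mvfderiv_congr {f g : M → ℝ} {x : M} (h : f =ᶠ[nhds x] g) :
    mvfderiv I f x = mvfderiv I g x := by
  ext v
  simp only [mvfderiv, h.mfderiv_eq]
  rfl

lemma tor_fsmul_left [hsmooth : CovariantDerivative.ContMDiffCovariantDerivative cov ∞]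
    (f : C^∞⟮I, M; 𝓘(ℝ, ℝ), ℝ⟯) (X Y : VField I M) :
    tor cov (fsmul f X) Y = fsmul f (tor cov X Y) := by
  ext y
  simp only [tor_apply, fsmul_apply, map_smul, smul_apply]

section Nabla

variable (cov) [hsmooth : CovariantDerivative.ContMDiffCovariantDerivative cov ∞]

lemma tor_swap (X Y : VField I M) : tor cov X Y = -tor cov Y X := by
  simp only [tor]
  rw [br_swap X Y]; abel

lemma nab_neg_right (X Z : VField I M) : nab cov X (-Z) = -nab cov X Z :=
  map_neg (AddMonoidHom.mk' (nab cov X) (nab_add_right cov X)) Z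

lemma nabTor_swap (W X Y : VField I M) : nabTor cov W X Y = -nabTor cov W Y X := by
  simp only [nabTor]
  rw [tor_swap cov X Y, tor_swap cov (nab cov W X) Y, tor_swap cov X (nab cov W Y),
    nab_neg_right]
  abel

lemma nabTor_fsmul_mid (f : C^∞⟮I, M; 𝓘(ℝ, ℝ), ℝ⟯) (W X Y : VField I M) (x : M) :
    nabTor cov W (fsmul f X) Y x = f x • nabTor cov W X Y x := by
  simp only [nabTor, tor_fsmul_left, ContMDiffSection.coe_sub, Pi.sub_apply,
    nab_fsmul_right, fsmul_apply]
  rw [tor_apply cov (nab cov W (fsmul f X)), nab_fsmul_right]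
  simp only [tor_apply, map_add, map_smul, add_apply,
    smul_apply]
  module

lemma nabTor_add_mid (W X X' Y : VField I M) :
    nabTor cov W (X + X') Y = nabTor cov W X Y + nabTor cov W X' Y := by
  simp only [nabTor, tor_add_left, nab_add_right]; abel

/-- Tensoriality is checked in the middle slot only; skewness transfers it to the last, and W enters
only through its value at x. -/
lemma nabTor_apply_congr {W X Y W' X' Y' : VField I M} {x : M}
    (hW : W x = W' x) (hX : X x = X' x) (hY : Y x = Y' x) :
    nabTor cov W X Y x = nabTor cov W' X' Y' x := by
  have h1 (W Y : VField I M) {X X' : VField I M} (h : X x = X' x) :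
      nabTor cov W X Y x = nabTor cov W X' Y x :=
    apply_eq_of_tensorial (fun X ↦ nabTor cov W X Y x)
      (fun X X' ↦ congr($(nabTor_add_mid cov W X X' Y) x))
      (fun f X ↦ nabTor_fsmul_mid cov f W X Y x) h
  rw [h1 W Y hX, nabTor_swap, nabTor_swap cov W']
  change -(nabTor cov W Y X' x) = -(nabTor cov W' Y' X' x)
  rw [h1 W X' hY]
  simp only [nabTor, ContMDiffSection.coe_sub, Pi.sub_apply, tor_apply, nab_apply, hW]

/-- Replaces the local fields `ext` by global ones with the same germ, then by arbitrary fields with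
the same value, since `nabTor` is tensorial. -/
lemma covDeriv3_torsion3_apply (hm : IsMetric cov) (W X Y Z : VField I M) (x : M) :
    covDeriv3 cov (torsion3 cov) x (W x) (X x) (Y x) (Z x) = ip (nabTor cov W X Y) Z x := by
  obtain ⟨X', hX⟩ := exists_vfield_ext (X x)
  obtain ⟨Y', hY⟩ := exists_vfield_ext (Y x)
  obtain ⟨Z', hZ⟩ := exists_vfield_ext (Z x)
  have hX' := hX.self_of_nhds.trans (ext_self _)
  have hY' := hY.self_of_nhds.trans (ext_self _)
  have hZ' := hZ.self_of_nhds.trans (ext_self _)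
  have hf : (fun y ↦ torsion3 cov y (ext I (X x) y) (ext I (Y x) y) (ext I (Z x) y))
      =ᶠ[nhds x] ip (tor cov X' Y') Z' := by
    filter_upwards [hX, hY, hZ] with y h1 h2 h3
    rw [← h1, ← h2, ← h3, torsion3_apply]
  rw [covDeriv3, mvfderiv_congr hf, hm.mvfderiv_ip, cov_congr cov hX, cov_congr cov hY,
    cov_congr cov hZ, ← nab_apply cov W X', ← nab_apply cov W Y', ← nab_apply cov W Z',
    ← hX', ← hY', ← hZ', torsion3_apply, torsion3_apply, torsion3_apply,
    ip_apply (nabTor cov W X Y) Z, nabTor_apply_congr cov rfl hX'.symm hY'.symm, ← hZ', ← ip_apply,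
    nabTor, ip_sub_left, ip_sub_left]
  ring

end Nabla

lemma covDeriv3_torsion3_swap_left (cov' : Connection I M) (x : M)
    (a b c d : TangentSpace I x) :
    covDeriv3 cov' (torsion3 cov) x a b c d = -covDeriv3 cov' (torsion3 cov) x a c b d := by
  have h : (fun y ↦ torsion3 cov y (ext I b y) (ext I c y) (ext I d y))
      = -fun y ↦ torsion3 cov y (ext I c y) (ext I b y) (ext I d y) :=
    funext fun y ↦ torsion3_swap_left _ _ _ _
  rw [covDeriv3, h, mvfderiv_neg, covDeriv3, neg_apply,
    torsion3_swap_left x _ c d, torsion3_swap_left x b _ d, torsion3_swap_left x b c]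
  ring

lemma HasSkewTorsion.covDeriv3_swap_right (hs : HasSkewTorsion cov) (cov' : Connection I M) (x : M)
    (a b c d : TangentSpace I x) :
    covDeriv3 cov' (torsion3 cov) x a b c d = -covDeriv3 cov' (torsion3 cov) x a b d c := by
  have h : (fun y ↦ torsion3 cov y (ext I b y) (ext I c y) (ext I d y))
      = -fun y ↦ torsion3 cov y (ext I b y) (ext I d y) (ext I c y) :=
    funext fun y ↦ hs _ _ _ _
  rw [covDeriv3, h, mvfderiv_neg, covDeriv3, neg_apply,
    hs x _ c d, hs x b _ d, hs x b c]
  ring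

/-- By the definition of torsion, [X_i,X_j] = ∇_i X_j - ∇_j X_i - T(X_i,X_j). The ∇_i X_j terms
cancel those from differentiating T on fields, and the six torsion terms add up to 2σ. -/
lemma HasSkewTorsion.extDeriv3_eq (hs : HasSkewTorsion cov) (x : M) (a b c d : TangentSpace I x) :
    extDeriv3 (torsion3 cov) x a b c d
      = covDeriv3 cov (torsion3 cov) x a b c d - covDeriv3 cov (torsion3 cov) x b a c d
        + covDeriv3 cov (torsion3 cov) x c a b d - covDeriv3 cov (torsion3 cov) x d a b c
        + 2 * sigma cov x a b c d := by
  have hd (w a b c : TangentSpace I x) :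
      mvfderiv I (fun y ↦ torsion3 cov y (ext I a y) (ext I b y) (ext I c y)) x w
        = covDeriv3 cov (torsion3 cov) x w a b c + torsion3 cov x (cov (ext I a) x w) b c
          - torsion3 cov x (cov (ext I b) x w) a c + torsion3 cov x (cov (ext I c) x w) a b := by
    rw [covDeriv3, torsion3_swap_left x a, hs.swap_mid x a b]
    ring
  have hb (a b c d : TangentSpace I x) :
      torsion3 cov x (VectorField.mlieBracket I (ext I a) (ext I b) x) c d
        = torsion3 cov x (cov (ext I b) x a) c d - torsion3 cov x (cov (ext I a) x b) c d
          - torsionPair cov x a b c d := by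
    rw [← hs.torsion3_torsion, ← torsion3_sub, ← torsion3_sub, cov.torsion_apply_eq_extend]
    congr 2
    simp only [FiberBundle.extend_apply_self, ext]
    abel
  rw [extDeriv3, extDerivOnFields]
  simp only [ext_self, hd, hb]
  rw [hs.sigma_eq, torsionPair_comm x c d, torsionPair_comm x b c, torsionPair_comm x b d]
  ring

/-- `curv_cyclic` paired with a fourth vector; the terms g(T(T(X,Y),Z),V) sum cyclically to σ. -/
lemma firstBianchi_sum [hsmooth : CovariantDerivative.ContMDiffCovariantDerivative cov ∞]
    (hm : IsMetric cov) (hs : HasSkewTorsion cov) (x : M) (a b c d : TangentSpace I x) :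
    curvature4 cov x a b c d + curvature4 cov x b c a d + curvature4 cov x c a b d
      = covDeriv3 cov (torsion3 cov) x a b c d + covDeriv3 cov (torsion3 cov) x b c a d
        + covDeriv3 cov (torsion3 cov) x c a b d + sigma cov x a b c d := by
  have hT (X Y Z V : VField I M) : ip (tor cov (tor cov X Y) Z) V x
      = torsionPair cov x (X x) (Y x) (Z x) (V x) := by
    rw [← torsion3_apply, tor_apply, hs.torsion3_torsion]
  obtain ⟨X, rfl⟩ := exists_vfield_apply a
  obtain ⟨Y, rfl⟩ := exists_vfield_apply b
  obtain ⟨Z, rfl⟩ := exists_vfield_apply c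
  obtain ⟨V, rfl⟩ := exists_vfield_apply d
  have h := congr(ip $(curv_cyclic cov X Y Z) V x)
  simp only [ip_add_left, hT] at h
  simp only [curvature4_apply cov hm, covDeriv3_torsion3_apply cov hm, h, hs.sigma_eq]
  rw [torsionPair_swap_left x (Z x) (X x), torsionPair_comm x (X x) (V x)]
  ring

end Torsion

/-! ### The equivalence of the first Bianchi identity with dT = -2∇T = 2σ/3. -/

section Equivalence

variable {E : Type*} [NormedAddCommGroup E] [NormedSpace ℝ E] [FiniteDimensional ℝ E]
  {H : Type*} [TopologicalSpace H] {I : ModelWithCorners ℝ E H}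
  {M : Type*} [TopologicalSpace M] [ChartedSpace H M] [IsManifold I ∞ M] [T2Space M]
  [RiemannianBundle (fun x : M ↦ TangentSpace I x)]
  [IsContMDiffRiemannianBundle I ∞ E (fun x : M ↦ TangentSpace I x)]
  {cov : Connection I M}

lemma HasSkewTorsion.sigma_swap_left (hs : HasSkewTorsion cov) (x : M)
    (a b c d : TangentSpace I x) : sigma cov x a b c d = -sigma cov x b a c d := by
  rw [hs.sigma_eq, hs.sigma_eq, torsionPair_swap_left x a b, torsionPair_comm x b c,
    torsionPair_comm x b d a c]
  rw [torsionPair_swap_right x a d b c, torsionPair_comm x a d]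
  rw [torsionPair_swap_left x c b, torsionPair_comm x b c]
  ring

lemma HasSkewTorsion.sigma_swap_mid (hs : HasSkewTorsion cov) (x : M)
    (a b c d : TangentSpace I x) : sigma cov x a b c d = -sigma cov x a c b d := by
  rw [hs.sigma_eq, hs.sigma_eq, torsionPair_swap_right x a d c b]
  ring

lemma HasSkewTorsion.sigma_swap_right (hs : HasSkewTorsion cov) (x : M)
    (a b c d : TangentSpace I x) : sigma cov x a b c d = -sigma cov x a b d c := by
  rw [hs.sigma_eq, hs.sigma_eq, torsionPair_swap_right x a b d c, torsionPair_swap_right x a c b d]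
  rw [torsionPair_swap_right x a c d b]
  ring

variable [hsmooth : CovariantDerivative.ContMDiffCovariantDerivative cov ∞]

/-- Put A = ∇_a T(b,c,d), B = -∇_b T(a,c,d), C = ∇_c T(a,b,d), D = -∇_d T(a,b,c). By skewness the
four cyclic shifts say that any three of these sum to -σ(a,b,c,d), so each equals -σ/3. -/
lemma FirstBianchi.covDeriv3_eq (hB : FirstBianchi cov) (hm : IsMetric cov)
    (hs : HasSkewTorsion cov) (x : M) (a b c d : TangentSpace I x) :
    covDeriv3 cov (torsion3 cov) x a b c d = -(1 / 3) * sigma cov x a b c d := by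
  have h (a b c d : TangentSpace I x) := (firstBianchi_sum hm hs x a b c d).symm.trans (hB x a b c d)
  have s1 := covDeriv3_torsion3_swap_left (cov := cov) cov x
  have s2 := hs.covDeriv3_swap_right cov x
  have t1 := hs.sigma_swap_left x
  have t2 := hs.sigma_swap_mid x
  have t3 := hs.sigma_swap_right x
  have e1 := h a b c d
  have e2 := h b c d a
  have e3 := h c d a b
  have e4 := h d a b c
  grind

lemma firstBianchi_iff (hm : IsMetric cov) (hs : HasSkewTorsion cov) :
    FirstBianchi cov ↔ ∀ (x : M) (a b c d : TangentSpace I x),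
      extDeriv3 (torsion3 cov) x a b c d = -2 * covDeriv3 cov (torsion3 cov) x a b c d ∧
      -2 * covDeriv3 cov (torsion3 cov) x a b c d = (2 / 3) * sigma cov x a b c d := by
  refine ⟨fun hB x a b c d ↦ ?_, fun h x a b c d ↦ ?_⟩
  · rw [hs.extDeriv3_eq]
    simp only [hB.covDeriv3_eq hm hs]
    rw [hs.sigma_swap_left x b a, hs.sigma_swap_left x c a, hs.sigma_swap_mid x a c,
      hs.sigma_swap_left x d a, hs.sigma_swap_mid x a d, hs.sigma_swap_right x a b d]
    constructor <;> ring
  · have hA (a b c d : TangentSpace I x) :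
        covDeriv3 cov (torsion3 cov) x a b c d = -(1 / 3) * sigma cov x a b c d := by
      linarith [(h x a b c d).2]
    rw [firstBianchi_sum hm hs]
    simp only [hA]
    rw [hs.sigma_swap_mid x b c, hs.sigma_swap_left x b a, hs.sigma_swap_left x c a,
      hs.sigma_swap_mid x a c]
    ring

end Equivalence

/-! ### The connections with torsion tT. -/

section Rescaled

variable {E : Type*} [NormedAddCommGroup E] [NormedSpace ℝ E] [FiniteDimensional ℝ E]
  {H : Type*} [TopologicalSpace H] {I : ModelWithCorners ℝ E H}
  {M : Type*} [TopologicalSpace M] [ChartedSpace H M] [IsManifold I ∞ M] [T2Space M]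
  [RiemannianBundle (fun x : M ↦ TangentSpace I x)]
  [IsContMDiffRiemannianBundle I ∞ E (fun x : M ↦ TangentSpace I x)]
  {cov : Connection I M}

lemma rescaledTorsion_apply (cov : Connection I M) (t : ℝ) (Y : Π y : M, TangentSpace I y) (x : M)
    (w : TangentSpace I x) :
    rescaledTorsion cov t Y x w = cov Y x w + ((1 - t) / 2) • cov.torsion x (Y x) w := rfl

lemma IsMetric.rescaledTorsion (hm : IsMetric cov) (hs : HasSkewTorsion cov) (t : ℝ) :
    IsMetric (rescaledTorsion cov t) := by
  intro x w Y Z hY hZ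
  rw [hm x w Y Z hY hZ, rescaledTorsion_apply, rescaledTorsion_apply, inner_add_left,
    inner_add_right]
  have h1 : inner ℝ (((1 - t) / 2) • cov.torsion x (Y x) w) (Z x)
      = (1 - t) / 2 * torsion3 cov x (Y x) w (Z x) :=
    real_inner_smul_left (cov.torsion x (Y x) w) (Z x) _
  have h2 : inner ℝ (Y x) (((1 - t) / 2) • cov.torsion x (Z x) w)
      = (1 - t) / 2 * torsion3 cov x (Z x) w (Y x) := by
    rw [← real_inner_comm]
    exact real_inner_smul_left (cov.torsion x (Z x) w) (Y x) _
  have h3 : torsion3 cov x (Y x) w (Z x) = -torsion3 cov x (Z x) w (Y x) := by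
    rw [hs.swap_mid, hs]
  rw [h1, h2, h3]
  ring

/-- The correction (1-t)/2 T enters the torsion twice, by antisymmetry, and leaves T - (1-t)T. -/
lemma torsion_rescaledTorsion (cov : Connection I M) (t : ℝ) (x : M) :
    (rescaledTorsion cov t).torsion x = t • cov.torsion x := by
  ext a b
  rw [CovariantDerivative.torsion_apply_eq_extend]
  simp only [rescaledTorsion_apply, FiberBundle.extend_apply_self, smul_apply]
  rw [cov.torsion_antisymm b a, cov.torsion_apply_eq_extend a b]
  simp only [FiberBundle.extend_apply_self]
  module

/-- The change of connection contributes one term T(T(·,w),·,·) for each of the three arguments;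
these are the three terms of σ. -/
lemma HasSkewTorsion.covDeriv3_rescaledTorsion (hs : HasSkewTorsion cov) (t : ℝ) (x : M)
    (w a b c : TangentSpace I x) :
    covDeriv3 (rescaledTorsion cov t) (torsion3 cov) x w a b c
      = covDeriv3 cov (torsion3 cov) x w a b c + (1 - t) / 2 * sigma cov x w a b c := by
  simp only [covDeriv3, rescaledTorsion_apply, ext_self]
  rw [torsion3_swap_left x a, hs.swap_mid x a b, torsion3_swap_left x a (cov (ext I b) x w),
    hs.swap_mid x a b (cov (ext I c) x w)]
  simp only [torsion3_add, torsion3_smul, hs.torsion3_torsion]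
  rw [hs.sigma_eq, torsionPair_swap_left x w a, torsionPair_swap_left x w b,
    torsionPair_swap_left x w c]
  ring

end Rescaled

/-! ### Traces of bilinear forms in orthonormal bases. -/

section LinearAlgebra

variable {V : Type*} [NormedAddCommGroup V] [InnerProductSpace ℝ V]
  {ι κ : Type*} [Fintype ι] [Fintype κ]

lemma bilin_eq_sum_left (e : OrthonormalBasis ι ℝ V) (β : V →ₗ[ℝ] V →ₗ[ℝ] ℝ) (u v : V) :
    β u v = ∑ k, inner ℝ (e k) u * β (e k) v := by
  conv_lhs => rw [← e.sum_repr' u]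
  simp [LinearMap.sum_apply]

lemma bilin_eq_sum_right (e : OrthonormalBasis ι ℝ V) (β : V →ₗ[ℝ] V →ₗ[ℝ] ℝ) (u v : V) :
    β u v = ∑ k, inner ℝ (e k) v * β u (e k) :=
  bilin_eq_sum_left e β.flip v u

/-- The trace of a bilinear form does not depend on the orthonormal basis. -/
lemma sum_bilin_eq (e : OrthonormalBasis ι ℝ V) (f : OrthonormalBasis κ ℝ V)
    (β : V →ₗ[ℝ] V →ₗ[ℝ] ℝ) : ∑ i, β (e i) (e i) = ∑ k, β (f k) (f k) := by
  calc ∑ i, β (e i) (e i) = ∑ i, ∑ k, inner ℝ (f k) (e i) * β (f k) (e i) :=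
        Finset.sum_congr rfl fun i _ ↦ bilin_eq_sum_left f β _ _
    _ = ∑ k, ∑ i, inner ℝ (e i) (f k) * β (f k) (e i) := by
        rw [Finset.sum_comm]
        simp only [real_inner_comm]
    _ = ∑ k, β (f k) (f k) :=
        Finset.sum_congr rfl fun k _ ↦ (bilin_eq_sum_right e β _ _).symm

/-- The trace of a bilinear form is stationary along infinitesimal rotations of the basis. -/
lemma sum_bilin_skew (e : OrthonormalBasis ι ℝ V) (u : ι → V)
    (hu : ∀ i j, inner ℝ (u i) (e j) + inner ℝ (e i) (u j) = 0) (β : V →ₗ[ℝ] V →ₗ[ℝ] ℝ) :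
    ∑ i, (β (u i) (e i) + β (e i) (u i)) = 0 := by
  have h1 : ∑ i, β (u i) (e i) = ∑ i, ∑ k, inner ℝ (e k) (u i) * β (e k) (e i) :=
    Finset.sum_congr rfl fun i _ ↦ bilin_eq_sum_left e β _ _
  have h2 : ∑ i, β (e i) (u i) = ∑ i, ∑ k, inner ℝ (e i) (u k) * β (e k) (e i) := by
    rw [Finset.sum_comm]
    exact Finset.sum_congr rfl fun i _ ↦ bilin_eq_sum_right e β _ _
  rw [Finset.sum_add_distrib, h1, h2, ← Finset.sum_add_distrib]
  refine Finset.sum_eq_zero fun i _ ↦ ?_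
  rw [← Finset.sum_add_distrib]
  refine Finset.sum_eq_zero fun k _ ↦ ?_
  rw [← add_mul, real_inner_comm, hu, zero_mul]

/-- The product of two linear forms as a bilinear form. -/
def mulBilin (φ : V →ₗ[ℝ] ℝ) (ψ : V →ₗ[ℝ] ℝ) : V →ₗ[ℝ] V →ₗ[ℝ] ℝ :=
  (LinearMap.mul ℝ ℝ).compl₁₂ φ ψ

@[simp] lemma mulBilin_apply (φ ψ : V →ₗ[ℝ] ℝ) (u v : V) : mulBilin φ ψ u v = φ u * ψ v := rfl

end LinearAlgebra

/-! ### Functions with zero differential. -/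

section LocallyConstant

variable {E : Type*} [NormedAddCommGroup E] [NormedSpace ℝ E]
  {H : Type*} [TopologicalSpace H] {I : ModelWithCorners ℝ E H} [I.Boundaryless]
  {M : Type*} [TopologicalSpace M] [ChartedSpace H M] [IsManifold I 1 M]

/-- Without boundary the chart target is open in E, so f read in the chart has zero derivative on a
ball, which is convex. -/
lemma isLocallyConstant_of_mvfderiv_eq_zero {f : M → ℝ} (hf : MDiff f)
    (h0 : ∀ x, mvfderiv I f x = 0) : IsLocallyConstant f := by
  rw [IsLocallyConstant.iff_eventually_eq]
  intro x
  have hd (z : E) (hz : z ∈ (extChartAt I x).target) :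
      HasFDerivAt (f ∘ (extChartAt I x).symm) (0 : E →L[ℝ] ℝ) z := by
    have h1 : MDiffAt (extChartAt I x).symm z :=
      ((contMDiffOn_extChartAt_symm (n := 1) x).contMDiffAt
        ((isOpen_extChartAt_target x).mem_nhds hz)).mdifferentiableAt one_ne_zero
    have h2 : HasMFDerivAt I 𝓘(ℝ, ℝ) f ((extChartAt I x).symm z) 0 := by
      have h3 : mfderiv I 𝓘(ℝ, ℝ) f ((extChartAt I x).symm z) = 0 := h0 _
      rw [← h3]
      exact (hf _).hasMFDerivAt
    have h4 := h2.comp z h1.hasMFDerivAt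
    rw [ContinuousLinearMap.zero_comp] at h4
    exact hasMFDerivAt_iff_hasFDerivAt.1 h4
  obtain ⟨r, hr, hb⟩ := Metric.isOpen_iff.1 (isOpen_extChartAt_target (I := I) x) _
    (mem_extChartAt_target x)
  have hc : ∀ z ∈ Metric.ball (extChartAt I x x) r,
      (f ∘ (extChartAt I x).symm) z = (f ∘ (extChartAt I x).symm) (extChartAt I x x) := by
    intro z hz
    exact Metric.isOpen_ball.is_const_of_fderiv_eq_zero (𝕜 := ℝ)
      (convex_ball _ _).isPreconnected
      (fun w hw ↦ (hd w (hb hw)).differentiableAt.differentiableWithinAt)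
      (fun w hw ↦ (hd w (hb hw)).fderiv) hz (Metric.mem_ball_self hr)
  filter_upwards [extChartAt_source_mem_nhds (I := I) x,
    (continuousAt_extChartAt (I := I) x).preimage_mem_nhds (Metric.ball_mem_nhds _ hr)] with y hy hy'
  have := hc _ hy'
  rwa [Function.comp_apply, Function.comp_apply, (extChartAt I x).left_inv hy,
    extChartAt_to_inv] at this

lemma eq_of_mem_connectedComponent {f : M → ℝ} (hf : MDifferentiable I 𝓘(ℝ, ℝ) f)
    (h0 : ∀ x, mvfderiv I f x = 0) {x y : M} (hy : y ∈ connectedComponent x) : f x = f y :=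
  (isLocallyConstant_of_mvfderiv_eq_zero (I := I) hf h0).apply_eq_of_isPreconnected
    isPreconnected_connectedComponent mem_connectedComponent hy

end LocallyConstant

/-! ### Directional derivatives as additive maps, for use under finite sums. -/

section DirectionalDerivative

variable {E : Type*} [NormedAddCommGroup E] [NormedSpace ℝ E]
  {H : Type*} [TopologicalSpace H] {I : ModelWithCorners ℝ E H}
  {M : Type*} [TopologicalSpace M] [ChartedSpace H M]

/-- The derivative of smooth functions in the direction of a tangent vector. -/
def dirDeriv (x : M) (w : TangentSpace I x) : C^∞⟮I, M; 𝓘(ℝ, ℝ), ℝ⟯ →+ ℝ :=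
  AddMonoidHom.mk' (fun f ↦ mvfderiv I f x w) fun f g ↦ by
    have := mvfderiv_add (f.contMDiff.mdifferentiableAt (x := x) (by simp))
      (g.contMDiff.mdifferentiableAt (x := x) (by simp))
    exact congr($this w)

lemma dirDeriv_apply (x : M) (w : TangentSpace I x) (f : C^∞⟮I, M; 𝓘(ℝ, ℝ), ℝ⟯) :
    dirDeriv x w f = mvfderiv I f x w := rfl

lemma dirDeriv_mul (x : M) (w : TangentSpace I x) (f g : C^∞⟮I, M; 𝓘(ℝ, ℝ), ℝ⟯) :
    dirDeriv x w (f * g) = f x * dirDeriv x w g + g x * dirDeriv x w f := by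
  have := mvfderiv_mul (f.contMDiff.mdifferentiableAt (x := x) (by simp))
    (g.contMDiff.mdifferentiableAt (x := x) (by simp))
  exact congr($this w)

lemma smooth_sum_apply {ι : Type*} (s : Finset ι) (f : ι → C^∞⟮I, M; 𝓘(ℝ, ℝ), ℝ⟯) (x : M) :
    (∑ i ∈ s, f i) x = ∑ i ∈ s, f i x := by
  have := congr_fun (map_sum (ContMDiffMap.coeFnAddMonoidHom (I := I) (N := M)
    (I' := 𝓘(ℝ, ℝ)) (G := ℝ) (n := ∞)) f s) x
  rw [Finset.sum_apply] at this
  exact this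

end DirectionalDerivative

lemma sum_rotate {ι κ μ : Type*} [Fintype ι] [Fintype κ] [Fintype μ] (f : ι → κ → μ → ℝ) :
    ∑ a, ∑ b, ∑ c, f a b c = ∑ b, ∑ c, ∑ a, f a b c := by
  rw [Finset.sum_comm]
  exact Finset.sum_congr rfl fun _ _ ↦ Finset.sum_comm

/-! ### Constancy of the norm of the torsion. -/

section TorsionNorm

variable {E : Type*} [NormedAddCommGroup E] [NormedSpace ℝ E] [FiniteDimensional ℝ E]
  {H : Type*} [TopologicalSpace H] {I : ModelWithCorners ℝ E H}
  {M : Type*} [TopologicalSpace M] [ChartedSpace H M] [IsManifold I ∞ M] [T2Space M]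
  [RiemannianBundle (fun x : M ↦ TangentSpace I x)]
  [IsContMDiffRiemannianBundle I ∞ E (fun x : M ↦ TangentSpace I x)]
  {cov : Connection I M}

/-- The torsion `3`-form with its last two arguments fixed. -/
def torsionForm (cov : Connection I M) (x : M) (b c : TangentSpace I x) :
    TangentSpace I x →ₗ[ℝ] ℝ where
  toFun a := torsion3 cov x a b c
  map_add' a a' := torsion3_add x a a' b c
  map_smul' r a := torsion3_smul x r a b c

lemma torsionForm_apply (x : M) (a b c : TangentSpace I x) :
    torsionForm cov x b c a = torsion3 cov x a b c := rfl

/-- The basis is changed one slot at a time; in each slot the sum of squares is the trace of a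
bilinear form. Frame independence lets the norm be computed in a moving frame. -/
lemma HasSkewTorsion.torsionNormSq_eq (hs : HasSkewTorsion cov) {x : M} {ι : Type*} [Fintype ι]
    (e : OrthonormalBasis ι ℝ (TangentSpace I x)) :
    torsionNormSq cov x = ∑ a, ∑ b, ∑ c, torsion3 cov x (e a) (e b) (e c) ^ 2 := by
  have s1 (b c : TangentSpace I x) : ∑ k, torsion3 cov x (frame I x k) b c ^ 2
      = ∑ k, torsion3 cov x (e k) b c ^ 2 := by
    have := sum_bilin_eq (frame I x) e (mulBilin (torsionForm cov x b c) (torsionForm cov x b c))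
    simpa only [mulBilin_apply, torsionForm_apply, ← sq] using this
  have s3 (a b : TangentSpace I x) : ∑ k, torsion3 cov x a b (frame I x k) ^ 2
      = ∑ k, torsion3 cov x a b (e k) ^ 2 := by
    simpa only [hs.swap_mid x a b] using s1 a b
  have s2 (a c : TangentSpace I x) : ∑ k, torsion3 cov x a (frame I x k) c ^ 2
      = ∑ k, torsion3 cov x a (e k) c ^ 2 := by
    simpa only [hs.swap_mid x a, hs.swap_mid x c a] using s1 c a
  unfold torsionNormSq
  simp only [s3]
  have h2 (a : TangentSpace I x) : ∑ b, ∑ c, torsion3 cov x a (frame I x b) (e c) ^ 2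
      = ∑ b, ∑ c, torsion3 cov x a (e b) (e c) ^ 2 := by
    rw [Finset.sum_comm]
    simp only [s2]
    exact Finset.sum_comm
  simp only [h2]
  refine (sum_rotate _).trans (Eq.trans ?_ (sum_rotate _).symm)
  exact Finset.sum_congr rfl fun b _ ↦ Finset.sum_congr rfl fun c _ ↦ s1 _ _

variable [hsmooth : CovariantDerivative.ContMDiffCovariantDerivative cov ∞]

lemma IsMetric.inner_nab_frame (hm : IsMetric cov) {ι : Type*} {e : ι → VField I M} {x : M}
    (he : ∀ᶠ y in nhds x, Orthonormal ℝ fun i ↦ e i y) (W : VField I M) (i j : ι) :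
    inner ℝ (nab cov W (e i) x) (e j x) + inner ℝ (e i x) (nab cov W (e j) x) = (0 : ℝ) := by
  classical
  have h : (ip (e i) (e j) : M → ℝ) =ᶠ[nhds x] fun _ ↦ if i = j then 1 else 0 := by
    filter_upwards [he] with y hy
    exact orthonormal_iff_ite.1 hy i j
  have := hm.mvfderiv_ip W (e i) (e j) x
  rw [mvfderiv_congr h, mvfderiv_const] at this
  exact this.symm

/-- This is ∇^{1/3}T = 0 in Leibniz form, for fields that need not be the local extensions `ext`. -/
lemma FirstBianchi.mvfderiv_torsion (hB : FirstBianchi cov) (hm : IsMetric cov)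
    (hs : HasSkewTorsion cov) (W X Y Z : VField I M) (x : M) :
    dirDeriv x (W x) (ip (tor cov X Y) Z)
      = torsion3 cov x (rescaledTorsion cov (1 / 3) X x (W x)) (Y x) (Z x)
        + torsion3 cov x (X x) (rescaledTorsion cov (1 / 3) Y x (W x)) (Z x)
        + torsion3 cov x (X x) (Y x) (rescaledTorsion cov (1 / 3) Z x (W x)) := by
  have h := hB.covDeriv3_eq hm hs x (W x) (X x) (Y x) (Z x)
  rw [covDeriv3_torsion3_apply cov hm, nabTor, ip_sub_left, ip_sub_left, ← torsion3_apply,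
    ← torsion3_apply, hs.sigma_eq] at h
  rw [dirDeriv_apply, hm.mvfderiv_ip, ip_apply (tor cov X Y), tor_apply]
  change _ + torsion3 cov x (X x) (Y x) (nab cov W Z x) = _
  simp only [rescaledTorsion_apply, ← nab_apply cov W]
  rw [hs.swap_mid x (X x) (Y x), hs.swap_mid x (X x) (Y x), torsion3_swap_left x (X x) (_ + _)]
  rw [torsion3_swap_left x (X x) (nab cov W Y x)] at h
  simp only [torsion3_add, torsion3_smul, hs.torsion3_torsion]
  rw [torsionPair_swap_left x (X x) (W x), torsionPair_swap_left x (Y x) (W x),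
    torsionPair_swap_left x (Z x) (W x)]
  linarith

lemma smooth_congr_mdifferentiableAt {f : M → ℝ} {g : C^∞⟮I, M; 𝓘(ℝ, ℝ), ℝ⟯} {x : M}
    (h : f =ᶠ[nhds x] g) : MDifferentiableAt I 𝓘(ℝ, ℝ) f x :=
  (mdifferentiableAt_smooth g x).congr_of_eventuallyEq h

/-- Near x the norm is a sum of squares of smooth functions T(e_a,e_b,e_c). Each derivative splits
into three terms in which one e_i becomes ∇^{1/3} e_i, and each resulting trace vanishes because
these vectors form an infinitesimal rotation. -/
lemma FirstBianchi.mvfderiv_torsionNormSq (hB : FirstBianchi cov) (hm : IsMetric cov)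
    (hs : HasSkewTorsion cov) (x : M) :
    MDifferentiableAt I 𝓘(ℝ, ℝ) (torsionNormSq cov) x ∧ mvfderiv I (torsionNormSq cov) x = 0 := by
  obtain ⟨e, hex, he⟩ := exists_frame (I := I) x
  let t (a b c) : C^∞⟮I, M; 𝓘(ℝ, ℝ), ℝ⟯ := ip (tor cov (e a) (e b)) (e c)
  let g : C^∞⟮I, M; 𝓘(ℝ, ℝ), ℝ⟯ := ∑ a, ∑ b, ∑ c, t a b c * t a b c
  have hg : torsionNormSq cov =ᶠ[nhds x] g := by
    filter_upwards [he] with y hy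
    rw [hs.torsionNormSq_eq (frameBasis e hy)]
    simp only [g, smooth_sum_apply, frameBasis_apply, torsion3_apply, sq]
    rfl
  refine ⟨smooth_congr_mdifferentiableAt hg, ?_⟩
  rw [mvfderiv_congr hg]
  ext w
  obtain ⟨W, rfl⟩ := exists_vfield_apply w
  rw [← dirDeriv_apply]
  let u (i) := rescaledTorsion cov (1 / 3) (e i) x (W x)
  -- Both ∇ and ∇^{1/3} are metric, so this sum equals the one for ∇, which vanishes on an
  -- orthonormal frame.
  have hu (i j) : inner ℝ (u i) (frame I x j) + inner ℝ (frame I x i) (u j) = 0 := by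
    have h := hm.inner_nab_frame he W i j
    have h' := (hm.rescaledTorsion hs (1 / 3)) x (W x) (e i) (e j) (e i).mdifferentiableAt
      (e j).mdifferentiableAt
    rw [hm x (W x) (e i) (e j) (e i).mdifferentiableAt (e j).mdifferentiableAt] at h'
    rw [← hex, ← hex]
    exact h'.symm.trans h
  have htx (a b c) : t a b c x = torsion3 cov x (frame I x a) (frame I x b) (frame I x c) := by
    rw [← hex, ← hex, ← hex, torsion3_apply]
  have hst (b c : TangentSpace I x) :
      ∑ a, torsion3 cov x (frame I x a) b c * torsion3 cov x (u a) b c = 0 := by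
    have := sum_bilin_skew (frame I x) u hu
      (mulBilin (torsionForm cov x b c) (torsionForm cov x b c))
    simp only [mulBilin_apply, torsionForm_apply] at this
    simp only [mul_comm (torsion3 cov x (u _) b c), ← two_mul, ← Finset.mul_sum] at this
    linarith
  have h3 (a b : TangentSpace I x) :
      ∑ c, torsion3 cov x a b (frame I x c) * torsion3 cov x a b (u c) = 0 := by
    simpa only [hs.swap_mid x a b] using hst a b
  have h2 (a c : TangentSpace I x) :
      ∑ b, torsion3 cov x a (frame I x b) c * torsion3 cov x a (u b) c = 0 := by
    simpa only [hs.swap_mid x a, hs.swap_mid x c a] using hst c a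
  simp only [g, map_sum, dirDeriv_mul, ← two_mul, htx]
  simp only [t, hB.mvfderiv_torsion hm hs, hex, mul_add, Finset.sum_add_distrib, zero_apply,
    ← Finset.mul_sum]
  have e3 : ∑ a, ∑ b, ∑ c, torsion3 cov x (frame I x a) (frame I x b) (frame I x c)
      * torsion3 cov x (frame I x a) (frame I x b) (u c) = 0 :=
    Finset.sum_eq_zero fun a _ ↦ Finset.sum_eq_zero fun b _ ↦ h3 _ _
  have e2 : ∑ a, ∑ b, ∑ c, torsion3 cov x (frame I x a) (frame I x b) (frame I x c)
      * torsion3 cov x (frame I x a) (u b) (frame I x c) = 0 := by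
    refine Finset.sum_eq_zero fun a _ ↦ ?_
    rw [Finset.sum_comm]
    exact Finset.sum_eq_zero fun b _ ↦ h2 _ _
  have e1 : ∑ a, ∑ b, ∑ c, torsion3 cov x (frame I x a) (frame I x b) (frame I x c)
      * torsion3 cov x (u a) (frame I x b) (frame I x c) = 0 := by
    rw [Finset.sum_comm]
    refine Finset.sum_eq_zero fun b _ ↦ ?_
    rw [Finset.sum_comm]
    exact Finset.sum_eq_zero fun c _ ↦ hst _ _
  simp only [u] at e1 e2 e3
  rw [e1, e2, e3]
  ring

end TorsionNorm

/-! ### Symmetries of R and Ric, and the contracted second Bianchi identity. -/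

section Contraction

variable {E : Type*} [NormedAddCommGroup E] [NormedSpace ℝ E] [FiniteDimensional ℝ E]
  {H : Type*} [TopologicalSpace H] {I : ModelWithCorners ℝ E H}
  {M : Type*} [TopologicalSpace M] [ChartedSpace H M] [IsManifold I ∞ M] [T2Space M]
  [RiemannianBundle (fun x : M ↦ TangentSpace I x)]
  [IsContMDiffRiemannianBundle I ∞ E (fun x : M ↦ TangentSpace I x)]
  {cov : Connection I M} [hsmooth : CovariantDerivative.ContMDiffCovariantDerivative cov ∞]

section Algebra

lemma curvature4_add_right (x : M) (a b c d d' : TangentSpace I x) :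
    curvature4 cov x a b c (d + d') = curvature4 cov x a b c d + curvature4 cov x a b c d' :=
  inner_add_right (curvature cov x a b c) d d'

lemma curvature4_smul_right (x : M) (r : ℝ) (a b c d : TangentSpace I x) :
    curvature4 cov x a b c (r • d) = r * curvature4 cov x a b c d :=
  real_inner_smul_right (curvature cov x a b c) d r

variable (hm : IsMetric cov) (x : M)
include hm

lemma IsMetric.curvature4_swap_left (a b c d : TangentSpace I x) :
    curvature4 cov x a b c d = -curvature4 cov x b a c d := by
  obtain ⟨X, rfl⟩ := exists_vfield_apply a
  obtain ⟨Y, rfl⟩ := exists_vfield_apply b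
  obtain ⟨Z, rfl⟩ := exists_vfield_apply c
  obtain ⟨V, rfl⟩ := exists_vfield_apply d
  rw [curvature4_apply cov hm, curvature4_apply cov hm, curv_swap]
  exact inner_neg_left (curv cov Y X Z x) (V x)

lemma IsMetric.curvature4_swap_right (a b c d : TangentSpace I x) :
    curvature4 cov x a b c d = -curvature4 cov x a b d c := by
  obtain ⟨X, rfl⟩ := exists_vfield_apply a
  obtain ⟨Y, rfl⟩ := exists_vfield_apply b
  obtain ⟨Z, rfl⟩ := exists_vfield_apply c
  obtain ⟨V, rfl⟩ := exists_vfield_apply d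
  rw [curvature4_apply cov hm, curvature4_apply cov hm, ip_curv_skew cov hm]

lemma IsMetric.curvature4_add_left (a a' b c d : TangentSpace I x) :
    curvature4 cov x (a + a') b c d = curvature4 cov x a b c d + curvature4 cov x a' b c d := by
  obtain ⟨X, rfl⟩ := exists_vfield_apply a
  obtain ⟨X', rfl⟩ := exists_vfield_apply a'
  obtain ⟨Y, rfl⟩ := exists_vfield_apply b
  obtain ⟨Z, rfl⟩ := exists_vfield_apply c
  obtain ⟨V, rfl⟩ := exists_vfield_apply d
  change curvature4 cov x ((X + X') x) _ _ _ = _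
  rw [curvature4_apply cov hm, curvature4_apply cov hm, curvature4_apply cov hm, curv_add_left,
    ip_add_left]

lemma IsMetric.curvature4_smul_left (r : ℝ) (a b c d : TangentSpace I x) :
    curvature4 cov x (r • a) b c d = r * curvature4 cov x a b c d := by
  obtain ⟨X, rfl⟩ := exists_vfield_apply a
  obtain ⟨Y, rfl⟩ := exists_vfield_apply b
  obtain ⟨Z, rfl⟩ := exists_vfield_apply c
  obtain ⟨V, rfl⟩ := exists_vfield_apply d
  change curvature4 cov x (fsmul (ContMDiffMap.const r) X x) _ _ _ = _
  rw [curvature4_apply cov hm, curvature4_apply cov hm, ip_apply, curv_fsmul_left]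
  exact real_inner_smul_left (curv cov X Y Z x) (V x) r

/-- The curvature as a bilinear form in its first and last arguments. -/
def IsMetric.curvatureForm (b c : TangentSpace I x) :
    TangentSpace I x →ₗ[ℝ] TangentSpace I x →ₗ[ℝ] ℝ :=
  LinearMap.mk₂ ℝ (fun a d ↦ curvature4 cov x a b c d)
    (fun a a' d ↦ hm.curvature4_add_left x a a' b c d)
    (fun r a d ↦ hm.curvature4_smul_left x r a b c d)
    (fun a d d' ↦ curvature4_add_right x a b c d d')
    (fun r a d ↦ curvature4_smul_right x r a b c d)

lemma IsMetric.curvature4_add_mid (a b b' c d : TangentSpace I x) :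
    curvature4 cov x a (b + b') c d = curvature4 cov x a b c d + curvature4 cov x a b' c d := by
  rw [hm.curvature4_swap_left, hm.curvature4_add_left, hm.curvature4_swap_left x a b,
    hm.curvature4_swap_left x a b']
  ring

lemma IsMetric.curvature4_smul_mid (r : ℝ) (a b c d : TangentSpace I x) :
    curvature4 cov x a (r • b) c d = r * curvature4 cov x a b c d := by
  rw [hm.curvature4_swap_left, hm.curvature4_smul_left, hm.curvature4_swap_left x a b]
  ring

lemma IsMetric.curvature4_add_third (a b c c' d : TangentSpace I x) :
    curvature4 cov x a b (c + c') d = curvature4 cov x a b c d + curvature4 cov x a b c' d := by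
  rw [hm.curvature4_swap_right, curvature4_add_right, hm.curvature4_swap_right x a b c,
    hm.curvature4_swap_right x a b c']
  ring

lemma IsMetric.curvature4_smul_third (r : ℝ) (a b c d : TangentSpace I x) :
    curvature4 cov x a b (r • c) d = r * curvature4 cov x a b c d := by
  rw [hm.curvature4_swap_right, curvature4_smul_right, hm.curvature4_swap_right x a b c]
  ring

/-- The Ricci tensor as a bilinear form. -/
def IsMetric.ricciForm : TangentSpace I x →ₗ[ℝ] TangentSpace I x →ₗ[ℝ] ℝ :=
  LinearMap.mk₂ ℝ (ricci cov x)
    (fun a a' d ↦ by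
      simp only [ricci, hm.curvature4_add_mid, Finset.sum_add_distrib])
    (fun r a d ↦ by
      simp only [ricci, hm.curvature4_smul_mid, ← Finset.mul_sum, smul_eq_mul])
    (fun a d d' ↦ by
      simp only [ricci, hm.curvature4_add_third, Finset.sum_add_distrib])
    (fun r a d ↦ by
      simp only [ricci, hm.curvature4_smul_third, ← Finset.mul_sum, smul_eq_mul])

lemma IsMetric.ricciForm_apply (a b : TangentSpace I x) :
    hm.ricciForm x a b = ricci cov x a b := rfl

lemma IsMetric.ricci_eq {ι : Type*} [Fintype ι] (e : OrthonormalBasis ι ℝ (TangentSpace I x))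
    (a b : TangentSpace I x) : ricci cov x a b = ∑ i, curvature4 cov x (e i) a b (e i) :=
  sum_bilin_eq (frame I x) e (hm.curvatureForm x a b)

lemma IsMetric.scal_eq {ι : Type*} [Fintype ι] (e : OrthonormalBasis ι ℝ (TangentSpace I x)) :
    scal cov x = ∑ i, ricci cov x (e i) (e i) :=
  sum_bilin_eq (frame I x) e (hm.ricciForm x)

variable (hB : FirstBianchi cov)
include hB

/-- The classical argument: the two skew symmetries combined with four cyclic shifts of the Bianchi
identity. -/
lemma FirstBianchi.curvature4_pair (a b c d : TangentSpace I x) :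
    curvature4 cov x a b c d = curvature4 cov x c d a b := by
  have s1 := hm.curvature4_swap_left x
  have s2 := hm.curvature4_swap_right x
  have e1 := hB x a b c d
  have e2 := hB x b c d a
  have e3 := hB x c d a b
  have e4 := hB x d a b c
  grind

lemma FirstBianchi.ricci_comm (a b : TangentSpace I x) : ricci cov x a b = ricci cov x b a := by
  refine Finset.sum_congr rfl fun i _ ↦ ?_
  rw [hB.curvature4_pair hm, hm.curvature4_swap_left, hm.curvature4_swap_right]
  ring

/-- The trace of the torsion against the curvature vanishes by the first Bianchi identity. -/
lemma FirstBianchi.sum_curvature4_torsion (hs : HasSkewTorsion cov) (v : TangentSpace I x) :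
    ∑ i, ∑ j, curvature4 cov x (cov.torsion x (frame I x i) (frame I x j)) v (frame I x j)
      (frame I x i) = 0 := by
  let S (i j k) : ℝ := torsion3 cov x (frame I x i) (frame I x j) (frame I x k)
    * curvature4 cov x (frame I x j) (frame I x i) (frame I x k) v
  have h1 (i j) : curvature4 cov x (cov.torsion x (frame I x i) (frame I x j)) v (frame I x j)
      (frame I x i) = ∑ k, S i j k := by
    refine (bilin_eq_sum_left (frame I x) (hm.curvatureForm x v (frame I x j)) _ _).trans ?_
    refine Finset.sum_congr rfl fun k _ ↦ ?_
    change _ * curvature4 cov x _ _ _ _ = _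
    rw [real_inner_comm, hB.curvature4_pair hm]
    rfl
  simp only [h1]
  -- Renaming indices gives three equal copies of the sum. Their total factors through the cyclic
  -- sum of R, because T is cyclically invariant.
  have h2 : ∑ i, ∑ j, ∑ k, S i j k = ∑ i, ∑ j, ∑ k, S k i j := sum_rotate S
  have h3 : ∑ i, ∑ j, ∑ k, S k i j = ∑ i, ∑ j, ∑ k, S j k i := sum_rotate fun i j k ↦ S k i j
  have h4 : ∑ i, ∑ j, ∑ k, (S i j k + S k i j + S j k i) = 0 := by
    refine Finset.sum_eq_zero fun i _ ↦ Finset.sum_eq_zero fun j _ ↦ Finset.sum_eq_zero fun k _ ↦ ?_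
    have := hB x (frame I x j) (frame I x i) (frame I x k) v
    simp only [S]
    rw [← hs.swap_mid x (frame I x i), hs.swap_mid x (frame I x j) (frame I x k), ← mul_add,
      ← mul_add, this, mul_zero]
  simp only [Finset.sum_add_distrib] at h4
  linarith

end Algebra

section Derivative

variable {κ : Type*} [Fintype κ]

/-- The Ricci tensor evaluated on two vector fields, as a trace along a family of fields. -/
def ricciField (cov : Connection I M)
    [hsmooth : CovariantDerivative.ContMDiffCovariantDerivative cov ∞]
    (e : κ → VField I M) (X Y : VField I M) : C^∞⟮I, M; 𝓘(ℝ, ℝ), ℝ⟯ :=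
  ∑ j, ip (curv cov (e j) X Y) (e j)

variable (hm : IsMetric cov) {x : M}
include hm

lemma IsMetric.ricciField_apply (e : κ → VField I M) (X Y : VField I M) (y : M) :
    ricciField cov e X Y y = ∑ j, curvature4 cov y (e j y) (X y) (Y y) (e j y) := by
  simp only [ricciField, smooth_sum_apply, curvature4_apply cov hm]

lemma IsMetric.ricciField_add_left (e : κ → VField I M) (X X' Y : VField I M) :
    ricciField cov e (X + X') Y = ricciField cov e X Y + ricciField cov e X' Y := by
  ext y
  change _ = ricciField cov e X Y y + ricciField cov e X' Y y
  simp only [hm.ricciField_apply, ← Finset.sum_add_distrib]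
  exact Finset.sum_congr rfl fun j _ ↦ hm.curvature4_add_mid y _ _ _ _ _

lemma IsMetric.ricciField_add_right (e : κ → VField I M) (X Y Y' : VField I M) :
    ricciField cov e X (Y + Y') = ricciField cov e X Y + ricciField cov e X Y' := by
  ext y
  change _ = ricciField cov e X Y y + ricciField cov e X Y' y
  simp only [hm.ricciField_apply, ← Finset.sum_add_distrib]
  exact Finset.sum_congr rfl fun j _ ↦ hm.curvature4_add_third y _ _ _ _ _

lemma IsMetric.ricciField_fsmul_left (e : κ → VField I M) (f : C^∞⟮I, M; 𝓘(ℝ, ℝ), ℝ⟯)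
    (X Y : VField I M) : ricciField cov e (fsmul f X) Y = f * ricciField cov e X Y := by
  ext y
  change _ = f y * ricciField cov e X Y y
  simp only [hm.ricciField_apply, Finset.mul_sum]
  exact Finset.sum_congr rfl fun j _ ↦ hm.curvature4_smul_mid y _ _ _ _ _

lemma IsMetric.ricciField_fsmul_right (e : κ → VField I M) (f : C^∞⟮I, M; 𝓘(ℝ, ℝ), ℝ⟯)
    (X Y : VField I M) : ricciField cov e X (fsmul f Y) = f * ricciField cov e X Y := by
  ext y
  change _ = f y * ricciField cov e X Y y
  simp only [hm.ricciField_apply, Finset.mul_sum]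
  exact Finset.sum_congr rfl fun j _ ↦ hm.curvature4_smul_third y _ _ _ _ _

variable {e : Fin (Module.finrank ℝ (TangentSpace I x)) → VField I M}
  (he : ∀ᶠ y in nhds x, Orthonormal ℝ fun i ↦ e i y)
include he

/-- `ricciField` is globally smooth by construction but is the Ricci tensor only where e is
orthonormal; this makes Ric differentiable at x. -/
lemma IsMetric.ricciField_eventuallyEq (X Y : VField I M) :
    (fun y ↦ ricci cov y (X y) (Y y)) =ᶠ[nhds x] ricciField cov e X Y := by
  filter_upwards [he] with y hy
  rw [hm.ricci_eq y (frameBasis e hy), hm.ricciField_apply]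
  simp only [frameBasis_apply]

lemma IsMetric.covDeriv2_ricci_apply (W X Y : VField I M) :
    covDeriv2 cov (ricci cov) x (W x) (X x) (Y x)
      = dirDeriv x (W x) (ricciField cov e X Y) - ricci cov x (nab cov W X x) (Y x)
        - ricci cov x (X x) (nab cov W Y x) := by
  -- Q is the Leibniz expression for ∇Ric. Its tensoriality in both slots permits replacing the
  -- extensions `ext` by X and Y.
  let Q (X Y : VField I M) : ℝ := dirDeriv x (W x) (ricciField cov e X Y)
    - hm.ricciForm x (nab cov W X x) (Y x) - hm.ricciForm x (X x) (nab cov W Y x)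
  have hQ (X Y : VField I M) : ricciField cov e X Y x = hm.ricciForm x (X x) (Y x) :=
    (hm.ricciField_eventuallyEq he X Y).self_of_nhds.symm
  obtain ⟨X', hX⟩ := exists_vfield_ext (X x)
  obtain ⟨Y', hY⟩ := exists_vfield_ext (Y x)
  have hX' := hX.self_of_nhds.trans (ext_self _)
  have hY' := hY.self_of_nhds.trans (ext_self _)
  have h1 : covDeriv2 cov (ricci cov) x (W x) (X x) (Y x) = Q X' Y' := by
    have hf : (fun y ↦ ricci cov y (ext I (X x) y) (ext I (Y x) y))
        =ᶠ[nhds x] ricciField cov e X' Y' := by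
      refine Filter.EventuallyEq.trans ?_ (hm.ricciField_eventuallyEq he X' Y')
      filter_upwards [hX, hY] with y h1 h2
      rw [h1, h2]
    rw [covDeriv2, mvfderiv_congr hf, cov_congr cov hX, cov_congr cov hY,
      ← nab_apply cov W X', ← nab_apply cov W Y', ← hX', ← hY']
    rfl
  have h2 : Q X' Y' = Q X Y' := by
    refine apply_eq_of_tensorial (fun X ↦ Q X Y') (fun X X' ↦ ?_) (fun f X ↦ ?_) hX'
    · simp only [Q, hm.ricciField_add_left, nab_add_right, map_add, ContMDiffSection.coe_add,
        Pi.add_apply, LinearMap.add_apply]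
      ring
    · simp only [Q, hm.ricciField_fsmul_left, nab_fsmul_right, dirDeriv_mul, map_add, map_smul,
        fsmul_apply, LinearMap.add_apply, LinearMap.smul_apply, hQ, smul_eq_mul, ← dirDeriv_apply]
      ring
  have h3 : Q X Y' = Q X Y := by
    refine apply_eq_of_tensorial (fun Y ↦ Q X Y) (fun Y Y' ↦ ?_) (fun f Y ↦ ?_) hY'
    · simp only [Q, hm.ricciField_add_right, nab_add_right, map_add, ContMDiffSection.coe_add,
        Pi.add_apply]
      ring
    · simp only [Q, hm.ricciField_fsmul_right, nab_fsmul_right, dirDeriv_mul, map_add, map_smul,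
        fsmul_apply, hQ, smul_eq_mul, ← dirDeriv_apply]
      ring
  rw [h1, h2, h3]
  rfl

lemma IsMetric.inner_nab_frameBasis (W : VField I M) (i j) :
    inner ℝ (nab cov W (e i) x) (frameBasis e he.self_of_nhds j)
      + inner ℝ (frameBasis e he.self_of_nhds i) (nab cov W (e j) x) = (0 : ℝ) := by
  rw [frameBasis_apply, frameBasis_apply]
  exact hm.inner_nab_frame he W i j

/-- The trace of `∇ Ric` is the derivative of the scalar curvature. -/
lemma IsMetric.sum_covDeriv2_ricci (W : VField I M) :
    ∑ i, covDeriv2 cov (ricci cov) x (W x) (e i x) (e i x) = mvfderiv I (scal cov) x (W x) := by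
  have hsc : scal cov =ᶠ[nhds x] (∑ i, ricciField cov e (e i) (e i) : C^∞⟮I, M; 𝓘(ℝ, ℝ), ℝ⟯) := by
    filter_upwards [he, he.eventually_nhds] with y hy hy'
    rw [hm.scal_eq y (frameBasis e hy), smooth_sum_apply]
    refine Finset.sum_congr rfl fun i _ ↦ ?_
    rw [hm.ricciField_apply, hm.ricci_eq y (frameBasis e hy)]
    simp only [frameBasis_apply]
  rw [mvfderiv_congr hsc, ← dirDeriv_apply, map_sum]
  have h := sum_bilin_skew (frameBasis e he.self_of_nhds) (fun i ↦ nab cov W (e i) x)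
    (hm.inner_nab_frameBasis he W) (hm.ricciForm x)
  simp only [frameBasis_apply, hm.ricciForm_apply, Finset.sum_add_distrib] at h
  simp only [hm.covDeriv2_ricci_apply he, Finset.sum_sub_distrib]
  linarith

/-- The covariant derivative of the Ricci tensor is a trace of that of the curvature. -/
lemma IsMetric.sum_nabCurv (W X Y : VField I M) :
    ∑ j, ip (nabCurv cov W (e j) X Y) (e j) x
      = covDeriv2 cov (ricci cov) x (W x) (X x) (Y x) := by
  -- The terms in which ∇ falls on the frame cancel in the trace.
  have h := sum_bilin_skew (frameBasis e he.self_of_nhds) (fun i ↦ nab cov W (e i) x)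
    (hm.inner_nab_frameBasis he W) (hm.curvatureForm x (X x) (Y x))
  simp only [frameBasis_apply] at h
  change ∑ i, (curvature4 cov x _ _ _ _ + curvature4 cov x _ _ _ _) = 0 at h
  simp only [curvature4_apply cov hm, Finset.sum_add_distrib] at h
  rw [hm.covDeriv2_ricci_apply he, ricciField, map_sum,
    hm.ricci_eq x (frameBasis e he.self_of_nhds), hm.ricci_eq x (frameBasis e he.self_of_nhds)]
  simp only [frameBasis_apply, curvature4_apply cov hm, dirDeriv_apply, hm.mvfderiv_ip]
  simp only [nabCurv, ip_sub_left, Finset.sum_sub_distrib, Finset.sum_add_distrib]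
  linarith

end Derivative

lemma nabCurv_swap (W X Y Z : VField I M) : nabCurv cov W X Y Z = -nabCurv cov W Y X Z := by
  simp only [nabCurv]
  rw [curv_swap cov X Y, curv_swap cov (nab cov W X) Y, curv_swap cov X (nab cov W Y),
    curv_swap cov X Y (nab cov W Z), nab_neg_right]
  abel

lemma ip_neg_left (X Y : VField I M) (x : M) : ip (-X) Y x = -ip X Y x :=
  inner_neg_left (X x) (Y x)

lemma IsMetric.ip_nabCurv_skew (hm : IsMetric cov) (W X Y Z V : VField I M) (x : M) :
    ip (nabCurv cov W X Y Z) V x = -ip (nabCurv cov W X Y V) Z x := by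
  have h : ip (curv cov X Y Z) V = -ip (curv cov X Y V) Z := by
    ext y
    exact ip_curv_skew cov hm X Y Z V y
  have h1 := hm.mvfderiv_ip W (curv cov X Y Z) V x
  have h2 := hm.mvfderiv_ip W (curv cov X Y V) Z x
  rw [h, ← dirDeriv_apply, map_neg, dirDeriv_apply] at h1
  simp only [nabCurv, ip_sub_left]
  rw [ip_curv_skew cov hm (nab cov W X), ip_curv_skew cov hm X (nab cov W Y),
    ip_curv_skew cov hm X Y (nab cov W Z), ip_curv_skew cov hm X Y (nab cov W V)]
  linarith

theorem FirstBianchi.contractedSecondBianchi (hB : FirstBianchi cov) (hm : IsMetric cov)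
    (hs : HasSkewTorsion cov) : ContractedSecondBianchi cov := by
  intro x v
  obtain ⟨X, rfl⟩ := exists_vfield_apply v
  obtain ⟨e, hex, he⟩ := exists_frame (I := I) x
  -- The second identity for X, e_i, e_j, applied to e_j and paired with e_i; summing over i and j
  -- is the double contraction.
  have key (i j) := congr(ip $(nabCurv_cyclic cov X (e i) (e j) (e j)) (e i) x)
  simp only [ip_add_left] at key
  have h0 (Y : VField I M) : ip 0 Y x = 0 := inner_zero_left (Y x)
  simp only [h0, ← curvature4_apply cov hm, tor_apply] at key
  have hsum := Finset.sum_eq_zero fun i (_ : i ∈ Finset.univ) ↦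
    Finset.sum_eq_zero fun j (_ : j ∈ Finset.univ) ↦ key i j
  simp only [Finset.sum_add_distrib] at hsum
  have d1 : ∑ i, ∑ j, ip (nabCurv cov X (e i) (e j) (e j)) (e i) x
      = mvfderiv I (scal cov) x (X x) := by
    rw [Finset.sum_comm, ← hm.sum_covDeriv2_ricci he]
    exact Finset.sum_congr rfl fun j _ ↦ hm.sum_nabCurv he X (e j) (e j)
  have d2 : ∑ i, ∑ j, ip (nabCurv cov (e i) (e j) X (e j)) (e i) x
      = -∑ i, covDeriv2 cov (ricci cov) x (e i x) (X x) (e i x) := by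
    rw [← Finset.sum_neg_distrib]
    refine Finset.sum_congr rfl fun i _ ↦ ?_
    rw [← hm.sum_nabCurv he, ← Finset.sum_neg_distrib]
    exact Finset.sum_congr rfl fun j _ ↦ hm.ip_nabCurv_skew _ _ _ _ _ _
  have d3 : ∑ i, ∑ j, ip (nabCurv cov (e j) X (e i) (e j)) (e i) x
      = -∑ i, covDeriv2 cov (ricci cov) x (e i x) (X x) (e i x) := by
    rw [Finset.sum_comm, ← Finset.sum_neg_distrib]
    refine Finset.sum_congr rfl fun i _ ↦ ?_
    rw [← hm.sum_nabCurv he, ← Finset.sum_neg_distrib]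
    refine Finset.sum_congr rfl fun j _ ↦ ?_
    rw [nabCurv_swap, ip_neg_left]
  -- The map T(X,·) is skew, so it acts as an infinitesimal rotation of the frame; symmetry of Ric
  -- makes the two halves of the stationary trace equal.
  have hric : ∑ i, ricci cov x (cov.torsion x (X x) (frame I x i)) (frame I x i) = 0 := by
    have h := sum_bilin_skew (frame I x) (fun i ↦ cov.torsion x (X x) (frame I x i))
      (fun i j ↦ by
        have h1 : torsion3 cov x (X x) (frame I x i) (frame I x j)
            = -torsion3 cov x (X x) (frame I x j) (frame I x i) := hs _ _ _ _
        rw [real_inner_comm (cov.torsion x (X x) (frame I x j))]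
        exact add_eq_zero_iff_eq_neg.2 h1) (hm.ricciForm x)
    have h' : ∑ i, ricci cov x (frame I x i) (cov.torsion x (X x) (frame I x i))
        = ∑ i, ricci cov x (cov.torsion x (X x) (frame I x i)) (frame I x i) :=
      Finset.sum_congr rfl fun i _ ↦ hB.ricci_comm hm x _ _
    simp only [hm.ricciForm_apply, Finset.sum_add_distrib] at h
    linarith
  have c1 (a b : TangentSpace I x) :
      ∑ j, curvature4 cov x a (frame I x j) (frame I x j) b = ricci cov x a b := by
    refine Finset.sum_congr rfl fun j _ ↦ ?_
    rw [hm.curvature4_swap_left, hm.curvature4_swap_right, neg_neg]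
  simp only [hex, c1] at hsum
  rw [hric, hB.sum_curvature4_torsion hm x hs] at hsum
  have t3 : ∑ i, ∑ j, curvature4 cov x (cov.torsion x (frame I x j) (X x)) (frame I x i)
      (frame I x j) (frame I x i) = 0 := by
    rw [Finset.sum_comm, ← hric]
    refine Finset.sum_congr rfl fun j _ ↦ ?_
    rw [← c1]
    refine Finset.sum_congr rfl fun i _ ↦ ?_
    rw [cov.torsion_antisymm, ← neg_one_smul ℝ (cov.torsion x (X x) (frame I x j)),
      hm.curvature4_smul_left, hm.curvature4_swap_right]
    ring
  rw [t3, d1, d2, d3] at hsum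
  simp only [hex] at hsum
  linarith

end Contraction

end

end SkewTorsion

theorem theorem1p2
    {E : Type*} [NormedAddCommGroup E] [NormedSpace ℝ E] [FiniteDimensional ℝ E]
    {H : Type*} [TopologicalSpace H] {I : ModelWithCorners ℝ E H} [I.Boundaryless]
    {M : Type*} [TopologicalSpace M] [T2Space M] [ChartedSpace H M] [IsManifold I ∞ M]
    [RiemannianBundle (fun x : M ↦ TangentSpace I x)]
    [IsContMDiffRiemannianBundle I ∞ E (fun x : M ↦ TangentSpace I x)]
    (cov : SkewTorsion.Connection I M)
    (hsmooth : CovariantDerivative.ContMDiffCovariantDerivative cov ∞)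
    (hmetric : SkewTorsion.IsMetric cov)
    (hskew : SkewTorsion.HasSkewTorsion cov) :
    (SkewTorsion.FirstBianchi cov ↔
      ∀ (x : M) (X Y Z V : TangentSpace I x),
        SkewTorsion.extDeriv3 (SkewTorsion.torsion3 cov) x X Y Z V
            = -2 * SkewTorsion.covDeriv3 cov (SkewTorsion.torsion3 cov) x X Y Z V ∧
          -2 * SkewTorsion.covDeriv3 cov (SkewTorsion.torsion3 cov) x X Y Z V
            = (2 / 3) * SkewTorsion.sigma cov x X Y Z V) ∧
    (SkewTorsion.FirstBianchi cov →
      (SkewTorsion.IsMetric (SkewTorsion.rescaledTorsion cov (1 / 3)) ∧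
        (∀ x : M, (SkewTorsion.rescaledTorsion cov (1 / 3)).torsion x
          = (1 / 3 : ℝ) • cov.torsion x) ∧
        ∀ (x : M) (W X Y Z : TangentSpace I x),
          SkewTorsion.covDeriv3 (SkewTorsion.rescaledTorsion cov (1 / 3))
            (SkewTorsion.torsion3 cov) x W X Y Z = 0) ∧
      (∀ x y : M, y ∈ connectedComponent x →
        SkewTorsion.torsionNormSq cov x = SkewTorsion.torsionNormSq cov y) ∧
      SkewTorsion.ContractedSecondBianchi cov) := by
  refine ⟨SkewTorsion.firstBianchi_iff hmetric hskew, fun hB ↦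
    ⟨⟨hmetric.rescaledTorsion hskew _, SkewTorsion.torsion_rescaledTorsion cov _,
      fun x W X Y Z ↦ ?_⟩, fun x y hy ↦ ?_, hB.contractedSecondBianchi hmetric hskew⟩⟩
  -- At t = 1/3 the coefficient (1-t)/2 is 1/3, cancelling -1/3.
  · rw [hskew.covDeriv3_rescaledTorsion, hB.covDeriv3_eq hmetric hskew]
    ring
  · exact SkewTorsion.eq_of_mem_connectedComponent (I := I)
      (fun z ↦ (hB.mvfderiv_torsionNormSq hmetric hskew z).1)
      (fun z ↦ (hB.mvfderiv_torsionNormSq hmetric hskew z).2) hy
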